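/- All groups are finite unless said otherwise. **Graphs.** For a directed graph $\mathcal D$ (loops allowed), two vertices are closed twins if they have the same closed out-neighbourhood. If closed twins of $\mathcal D$ have equal out-degrees, the reduced graph $R(\mathcal D)$ is the vertex-coloured directed graph whose vertices are the closed twin-classes, where the colour $\mathrm{col}(\tau)$ of a class $\tau$ is the out-degree in $\mathcal D$ of any of its members (a loop counts), and where there is an edge from $\tau_1$ to $\tau_2\neq\tau_1$ if $\mathcal D$ has an edge from some member of $\tau_1$ to some member of $\tau_2$. A *reduced directed graph* is a vertex-coloured directed graph that is colour-isomorphic to $R(\mathcal D)$ for some finite $\mathcal D$. Colour-isomorphism (isomorphism preserving colours) is written $\cong_c$. $DPow(G)$ is the directed graph on $G$ with edges $(x,x^m)$, $m\ge 1$; the vertices of $R(DPow(G))$ are the classes $[x]=\{y:\langle y\rangle=\langle x\rangle\}$, and $[x]$ has colour $\mathrm{ord}(x)$. A *common parent* of vertices $u_i$ is a vertex $w$ such that for each $i$ either $w=u_i$ or $(w,u_i)$ is an edge; it is a *least common parent* if its colour is minimal among all common parents. **Algorithms.** An algorithm is a program in a fixed deterministic language of while-programs on binary trees, in which every elementary step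 costs at least the size of the tree it works on. A reduced directed graph is given by the list of its vertices, each with its colour in unary and its row of the adjacency matrix; polynomial time means polynomial in the length of this input. **Statement.** (1) There are a program $\mathcal M$, which may call a subroutine, and a constant $c$ such that the following holds for every isomorphism-closed class $\mathcal X$ of finite groups of prime-power order. Let $Nil(\mathcal X)$ be the class of finite nilpotent groups $H$ whose Sylow $p$-subgroups, for all primes $p$ dividing $|H|$, are in $\mathcal X$. Let $\mathcal A$ be a polynomial-time algorithm that, on input a reduced directed graph $\mathcal D'$, decides whether $\mathcal D'\cong_c R(DPow(G))$ for some $G\in\mathcal X$ and, if so, returns such a $G$ (as a Cayley table) together with a colour-preserving isomorphism $\psi:V(R(DPow(G)))\to V(\mathcal D')$. Then $\mathcal A_{nil}$, that is, $\mathcal M$ with $\mathcal A$ as its subroutine, is a polynomial-time algorithm (the time spent in $\mathcal A$ included) that, on input a reduced directed graph $\mathcal D$ with $n$ vertices, decides whether $\mathcal D\cong_c R(DPow(H))$ for some $H\in Nil(\mathcal X)$, and it calls $\mathcal A$ at most $c\,n$ times. (2) Let $(p_i)_{i\in I}$ be a finite family of distinct primes, let $G_i$ and $H_i$ be finite $p_i$-groups,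 let $\mathcal D_1=R(DPow(\prod_i G_i))$ and $\mathcal D_2=R(DPow(\prod_i H_i))$, and for $j=1,2$ let $\mathcal D_{ji}$ be the subgraph of $\mathcal D_j$ induced on the vertices whose colour is a power of $p_i$ (including $p_i^0=1$). Let $f_i:V(\mathcal D_{2i})\to V(\mathcal D_{1i})$ be a colour-preserving isomorphism for each $i$. Then there is a colour-preserving isomorphism $f:V(\mathcal D_2)\to V(\mathcal D_1)$ with $f|_{V(\mathcal D_{2i})}=f_i$ for all $i$, such that for all $x=(x_i)_{i\in I}$ the vertex $f([x])$ is the unique least common parent in $\mathcal D_1$ of the vertices $f_i([x_i])$, where $[x_i]$ denotes the class of the element of $\prod_i H_i$ with $i$-th component $x_i$ and all other components trivial. -/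

import Mathlib

namespace PowRec

/-! ## Vertex-coloured directed graphs, reduced graphs and directed power graphs -/

section Graphs

variable {V W : Type*}

/-- A vertex-coloured directed graph; colours are natural numbers. -/
structure ColDigraph (V : Type*) extends Digraph V where
  col : V → ℕ

/-- A colour-preserving isomorphism of vertex-coloured directed graphs. -/
structure ColIso (C : ColDigraph V) (D : ColDigraph W) extends V ≃ W where
  map_adj : ∀ u v, D.Adj (toFun u) (toFun v) ↔ C.Adj u v
  map_col : ∀ u, D.col (toFun u) = C.col u

instance (C : ColDigraph V) (D : ColDigraph W) : CoeFun (ColIso C D) (fun _ => V → W) :=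
  ⟨fun f => f.toFun⟩

/-- The subgraph induced on the set of vertices whose colour is a power of `p`
(the colour `1 = p ^ 0` included). -/
def ColDigraph.part (C : ColDigraph V) (p : ℕ) : ColDigraph {v : V // ∃ k : ℕ, C.col v = p ^ k} where
  Adj u v := C.Adj u.1 v.1
  col u := C.col u.1

/-- `w` is a common parent of the family `u`. The reduced graph has no loops, whereas in a directed
power graph every vertex has a loop, so every vertex counts as a parent of itself. -/
def IsCommonParent {ι : Type*} (C : ColDigraph V) (u : ι → V) (w : V) : Prop :=
  ∀ i, w = u i ∨ C.Adj w (u i)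

/-- `w` is a least common parent of the family `u`: a common parent of least colour. -/
def IsLeastCommonParent {ι : Type*} (C : ColDigraph V) (u : ι → V) (w : V) : Prop :=
  IsCommonParent C u w ∧ ∀ w', IsCommonParent C u w' → C.col w ≤ C.col w'

/-- The closed out-neighbourhood of a vertex. -/
def closedOut (D : Digraph V) (v : V) : Set V := {w | w = v ∨ D.Adj v w}

/-- The out-degree of a vertex (a loop counts). -/
noncomputable def outDeg (D : Digraph V) (v : V) : ℕ := {w | D.Adj v w}.ncard

/-- Two vertices are closed twins if their closed out-neighbourhoods are the same. -/
def twinSetoid (D : Digraph V) : Setoid V where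
  r u v := closedOut D u = closedOut D v
  iseqv := ⟨fun _ => rfl, fun h => h.symm, fun h h' => h.trans h'⟩

/-- The vertex set of the reduced graph: the closed twin-classes. -/
abbrev TwinClass (D : Digraph V) : Type _ := Quotient (twinSetoid D)

/-- The closed twin-class of a vertex. -/
def cls (D : Digraph V) (v : V) : TwinClass D := Quotient.mk (twinSetoid D) v

/-- The reduced graph `R(D)`: the vertices are the closed twin-classes, a class is coloured by the
out-degree of any of its members, and there is an edge between two different classes if there is an
edge from some member of the first to some member of the second. -/
noncomputable def reduced (D : Digraph V) : ColDigraph (TwinClass D) where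
  Adj a b := a ≠ b ∧ ∃ x y, cls D x = a ∧ cls D y = b ∧ D.Adj x y
  col a := outDeg D (Quotient.out a)

/-- Closed twins have the same out-degree, so that the colouring of `reduced D` does not depend on
the choice of representatives. This holds, for example, if every vertex of `D` has a loop, or if
no vertex has one. -/
def TwinsSameOutDeg (D : Digraph V) : Prop :=
  ∀ u v, closedOut D u = closedOut D v → outDeg D u = outDeg D v

/-- A reduced directed graph: a vertex-coloured directed graph that is (up to colour-preserving
isomorphism) the reduced graph of some finite directed graph. -/
def IsReducedDigraph (C : ColDigraph V) : Prop :=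
  ∃ (W : Type) (_ : Finite W) (D : Digraph W),
    TwinsSameOutDeg D ∧ Nonempty (ColIso (reduced D) C)

/-- The directed power graph of a group. -/
def dpow (G : Type*) [Group G] : Digraph G where
  Adj x y := ∃ m : ℕ, 0 < m ∧ y = x ^ m

/-- The reduced directed power graph `R(DPow(G))`. -/
noncomputable def rdpow (G : Type*) [Group G] : ColDigraph (TwinClass (dpow G)) :=
  reduced (dpow G)

/-- The class `[x]` as a vertex of `R(DPow(G))`. -/
def pcls {G : Type*} [Group G] (x : G) : TwinClass (dpow G) := cls (dpow G) x

/-- `C` is colour-isomorphic to `R(DPow(G))` for some `G` in the class `X`. -/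
def IsRDPowOf (X : (G : Type) → [Group G] → Prop) (C : ColDigraph V) : Prop :=
  ∃ (G : Type) (_ : Group G), X G ∧ Nonempty (ColIso (rdpow G) C)

/-- The class of finite nilpotent groups whose Sylow subgroups (for the primes dividing the order)
are in `X`. -/
def Nil (X : (G : Type) → [Group G] → Prop) (G : Type) [Group G] : Prop :=
  Finite G ∧ Group.IsNilpotent G ∧
    ∀ p : ℕ, p.Prime → p ∣ Nat.card G → ∀ P : Sylow p G, X (P : Subgroup G)

end Graphs

/-! ### The colour of a vertex of `R(DPow(G))` is the order of the elements of the class -/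

section Colour

variable {G : Type*} [Group G]

theorem closedOut_dpow (x : G) : closedOut (dpow G) x = {w | (dpow G).Adj x w} := by
  ext w
  constructor
  · rintro (rfl | h)
    · exact ⟨1, one_pos, (pow_one _).symm⟩
    · exact h
  · exact fun h => Or.inr h

theorem outDeg_dpow [Finite G] (x : G) : outDeg (dpow G) x = orderOf x := by
  have h : {w | (dpow G).Adj x w} = (Subgroup.zpowers x : Set G) := by
    ext w
    constructor
    · rintro ⟨m, -, rfl⟩
      exact ⟨m, by simp⟩
    · intro hw
      obtain ⟨m, rfl⟩ := mem_powers_iff_mem_zpowers.2 hw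
      exact ⟨m + orderOf x, Nat.add_pos_right _ (orderOf_pos x), by simp [pow_add, pow_orderOf_eq_one]⟩
  rw [outDeg, h, ← Nat.card_zpowers]
  rfl

theorem twinsSameOutDeg_dpow : TwinsSameOutDeg (dpow G) := by
  intro u v h
  rw [closedOut_dpow, closedOut_dpow] at h
  rw [outDeg, outDeg, h]

theorem col_pcls [Finite G] (x : G) : (rdpow G).col (pcls x) = orderOf x := by
  rw [← outDeg_dpow x]
  exact twinsSameOutDeg_dpow _ _ (Quotient.mk_out (s := twinSetoid (dpow G)) x)

open Classical in
/-- In a product of finite groups, one of which has order a power of `p`, the class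
`[(e, …, e, a, e, …, e)]` has `p`-power colour. -/
theorem col_mulSingle {ι : Type} [Fintype ι] {p : ℕ} (hp : p.Prime) (G : ι → Type)
    [∀ i, Group (G i)] [∀ i, Finite (G i)] (i : ι) (hG : ∃ k : ℕ, Nat.card (G i) = p ^ k)
    (a : G i) : ∃ k : ℕ, (rdpow (∀ i, G i)).col (pcls (Pi.mulSingle i a)) = p ^ k := by
  obtain ⟨k, hk⟩ := hG
  rw [col_pcls]
  have h : orderOf (Pi.mulSingle i a : ∀ i, G i) ∣ p ^ k := by
    rw [← hk, orderOf_dvd_iff_pow_eq_one, ← Pi.mulSingle_pow, pow_card_eq_one', Pi.mulSingle_one]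
  obtain ⟨j, -, hj⟩ := (Nat.dvd_prime_pow hp).1 h
  exact ⟨j, hj⟩

open Classical in
/-- The class `[(e, …, e, a, e, …, e)]` as a vertex of the `p`-part of `R(DPow(∏ G i))`. -/
noncomputable def singleVertex {ι : Type} [Fintype ι] {p : ℕ} (hp : p.Prime) (G : ι → Type)
    [∀ i, Group (G i)] [∀ i, Finite (G i)] (i : ι) (hG : ∃ k : ℕ, Nat.card (G i) = p ^ k)
    (a : G i) :
    {v : TwinClass (dpow (∀ i, G i)) // ∃ k : ℕ, (rdpow (∀ i, G i)).col v = p ^ k} :=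
  ⟨pcls (Pi.mulSingle i a), col_mulSingle hp G i hG a⟩

end Colour

/-! ## The machine model: a language of while-programs over binary trees -/

/-- The data of the machine: finite binary trees. -/
inductive Data
  | leaf : Data
  | node (l r : Data) : Data

/-- The number of constructors of a tree. -/
def Data.size : Data → ℕ
  | .leaf => 1
  | .node l r => 1 + l.size + r.size

/-- The first component of a tree. -/
def Data.fst : Data → Data
  | .leaf => .leaf
  | .node l _ => l

/-- The second component of a tree. -/
def Data.snd : Data → Data
  | .leaf => .leaf
  | .node _ r => r

/-- Programs, each of which transforms one tree into another. The state of a computation is a tree;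
`pair` runs two programs on copies of the state, `comp p q` runs `p` and then `q`, `ite c p q` and
`loop c p` (while `c` is true, do `p`) test whether the value of `c` is different from `leaf`, and
`call` replaces the state by the answer of a subroutine. -/
inductive Prog
  | leaf : Prog
  | id : Prog
  | fst : Prog
  | snd : Prog
  | pair (p q : Prog) : Prog
  | comp (p q : Prog) : Prog
  | ite (c p q : Prog) : Prog
  | loop (c p : Prog) : Prog
  | call : Prog

/-- Deterministic big-step semantics with cost. `Eval S p x y t k`: the program `p` on the state `x`
halts with the state `y` after time `t`, having called the subroutine `k` times. Here `S x y t`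
means that the subroutine on input `x` halts with answer `y` after time `t`. Every elementary step
is charged the size of the tree that it reads or copies, so that the time bounds the size of all
trees that occur, and the time of the subroutine is charged in full. -/
inductive Eval (S : Data → Data → ℕ → Prop) : Prog → Data → Data → ℕ → ℕ → Prop
  | leaf (x : Data) : Eval S .leaf x .leaf (1 + x.size) 0
  | id (x : Data) : Eval S .id x x (1 + x.size) 0
  | fst (x : Data) : Eval S .fst x x.fst (1 + x.size) 0
  | snd (x : Data) : Eval S .snd x x.snd (1 + x.size) 0
  | pair {p q : Prog} {x y z : Data} {t t' k k' : ℕ} :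
      Eval S p x y t k → Eval S q x z t' k' →
      Eval S (.pair p q) x (.node y z) (1 + t + t') (k + k')
  | comp {p q : Prog} {x y z : Data} {t t' k k' : ℕ} :
      Eval S p x y t k → Eval S q y z t' k' →
      Eval S (.comp p q) x z (1 + t + t') (k + k')
  | ite_true {c p q : Prog} {x b b' y : Data} {t t' k k' : ℕ} :
      Eval S c x (.node b b') t k → Eval S p x y t' k' →
      Eval S (.ite c p q) x y (1 + t + t') (k + k')
  | ite_false {c p q : Prog} {x y : Data} {t t' k k' : ℕ} :
      Eval S c x .leaf t k → Eval S q x y t' k' →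
      Eval S (.ite c p q) x y (1 + t + t') (k + k')
  | loop_done {c p : Prog} {x : Data} {t k : ℕ} :
      Eval S c x .leaf t k →
      Eval S (.loop c p) x x (1 + t) k
  | loop_step {c p : Prog} {x b b' y z : Data} {t t' t'' k k' k'' : ℕ} :
      Eval S c x (.node b b') t k → Eval S p x y t' k' → Eval S (.loop c p) y z t'' k'' →
      Eval S (.loop c p) x z (1 + t + t' + t'') (k + k' + k'')
  | call {x y : Data} {t : ℕ} :
      S x y t → Eval S .call x y (1 + x.size + t) 1

/-- `Run A x y t`: the program `A`, without any subroutine, on input `x` halts with output `y` after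
time `t`. -/
def Run (A : Prog) (x y : Data) (t : ℕ) : Prop :=
  Eval (fun _ _ _ => False) A x y t 0

/-- `RunWith A M x y t k`: the program `M`, with the program `A` as its subroutine, on input `x`
halts with output `y` after time `t` (the time spent in `A` included) and `k` calls of `A`. -/
def RunWith (A M : Prog) (x y : Data) (t k : ℕ) : Prop :=
  Eval (Run A) M x y t k

/-! ## Encodings -/

/-- Lists. -/
def encList : List Data → Data
  | [] => .leaf
  | a :: l => .node a (encList l)

/-- Natural numbers, in unary. -/
def encNat : ℕ → Data
  | 0 => .leaf
  | n + 1 => .node .leaf (encNat n)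

open Classical in
/-- Truth values: `leaf` is "no". -/
noncomputable def encProp (P : Prop) : Data := if P then .node .leaf .leaf else .leaf

/-- A coloured directed graph on `n` vertices: for each vertex its colour and its row of the adjacency
matrix. -/
noncomputable def encGraph {n : ℕ} (C : ColDigraph (Fin n)) : Data :=
  encList (List.ofFn fun i =>
    .node (encNat (C.col i)) (encList (List.ofFn fun j => encProp (C.Adj i j))))

/-- The Cayley table of a group whose elements are numbered by `e`. -/
def encTable {G : Type} [Group G] {m : ℕ} (e : G ≃ Fin m) : Data :=
  encList (List.ofFn fun i => encList (List.ofFn fun j =>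
    encNat (e (e.symm i * e.symm j) : Fin m)))

/-- A map from the vertices `[x]` of `R(DPow(G))` to `Fin n`: the list of the images of `[x]`, where
`x` runs through the elements of `G` as numbered by `e`. -/
def encMap {G : Type} [Group G] {m n : ℕ} (e : G ≃ Fin m) (f : TwinClass (dpow G) → Fin n) : Data :=
  encList (List.ofFn fun i => encNat (f (pcls (e.symm i)) : Fin n))

/-! ## Recognition algorithms -/

/-- `y` is a correct answer to the question whether `C` is colour-isomorphic to `R(DPow(G))` for some
`G` in `X`: if so, `y` consists of the Cayley table of such a `G` and of a colour-preserving
isomorphism from `R(DPow(G))` to `C`; if not, `y` is "no". -/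
def IsAnswer (X : (G : Type) → [Group G] → Prop) {n : ℕ} (C : ColDigraph (Fin n)) (y : Data) :
    Prop :=
  (IsRDPowOf X C → ∃ (G : Type) (_ : Group G) (m : ℕ) (e : G ≃ Fin m) (f : ColIso (rdpow G) C),
    X G ∧ y = .node (encTable e) (encMap e f)) ∧
  (¬ IsRDPowOf X C → y = .leaf)

/-- `A` is a polynomial-time algorithm that, on input a reduced directed graph, decides whether it is
colour-isomorphic to `R(DPow(G))` for some `G` in `X` and, if so, returns such a `G` and a
colour-preserving isomorphism. -/
def IsPolyRecognizer (X : (G : Type) → [Group G] → Prop) (A : Prog) : Prop :=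
  ∃ P : Polynomial ℕ, ∀ (n : ℕ) (C : ColDigraph (Fin n)), IsReducedDigraph C →
    ∃ (y : Data) (t : ℕ), Run A (encGraph C) y t ∧ t ≤ P.eval (encGraph C).size ∧ IsAnswer X C y

/-- With the subroutine `A`, the program `M` is a polynomial-time algorithm that, on input a reduced
directed graph with `n` vertices, decides whether it is colour-isomorphic to `R(DPow(H))` for some
`H` in `Y`, and calls `A` at most `c * n` times. -/
def IsPolyDeciderWithCalls (Y : (G : Type) → [Group G] → Prop) (A M : Prog) (c : ℕ) : Prop :=
  ∃ Q : Polynomial ℕ, ∀ (n : ℕ) (C : ColDigraph (Fin n)), IsReducedDigraph C →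
    ∃ t k : ℕ, RunWith A M (encGraph C) (encProp (IsRDPowOf Y C)) t k ∧
      t ≤ Q.eval (encGraph C).size ∧ k ≤ c * n

end PowRec

namespace PowRec

open Subgroup

/-! ## Products of groups of prime power order for distinct primes -/

section Family

/-! Both halves rest on the Chinese remainder theorem. In a product of groups of coprime prime power
orders, `y ∈ zpowers x` holds exactly when it holds in every component, and the order of `x` is the
product of the orders of its components (`IsPrimePowerFamily.mem_zpowers_iff`,
`IsPrimePowerFamily.orderOf_pi`). The edges and colours of the reduced power graph of the product
are thus determined by its primary parts.

For the gluing, each `f i` is represented by a map on elements `g i : H i → G i`, which need not be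
a homomorphism but respects membership in cyclic subgroups and orders. Applied componentwise, these
maps show that the elements of `∏ H i` describe the graph of `∏ G i` as well as their own
(`Presents`), and two graphs described by the same group are isomorphic. The common parents of the
`f i [x i]` are the classes of those `z` with `(g i (x i)) ∈ zpowers z`, and the least order is
attained only if `z` generates the same cyclic group.

For the algorithm, a purely order-theoretic criterion avoids arithmetic on colours such as testing
primality. In the graph of a nilpotent group the atoms are the classes of elements of prime order,
and the vertices primary for the colour `p` of an atom are the classes of `p`-elements. Such a graph
satisfies the axioms `ColDigraph.IsProductLike`, and each primary part is the graph of a Sylow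
subgroup (`isProductLike_of_isRDPowOf_nil`). Conversely, the axioms allow the groups found for the
primary parts to be multiplied together (`ColDigraph.IsProductLike.isRDPowOf_nil`). The axioms are
quantifiers over vertices, hence decidable in polynomial time. The program checks them and then runs
through the vertices, calling the subroutine once for each atom; this gives at most `n` calls.
Transitivity, tested beforehand, makes the primary parts closed under out-neighbours, hence reduced
(`IsReducedDigraph.comap`), so the promise on the subroutine applies. -/

/-- A family of groups, the `i`-th of which has order a power of the prime `p i`, where the primes
are distinct. -/
structure IsPrimePowerFamily {ι : Type*} (p : ι → ℕ) (G : ι → Type*) [∀ i, Group (G i)] : Prop where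
  prime : ∀ i, (p i).Prime
  inj : Function.Injective p
  card : ∀ i, ∃ k : ℕ, Nat.card (G i) = p i ^ k

theorem exists_orderOf_eq_prime_pow_of_card {G : Type*} [Group G] {p : ℕ} (hp : p.Prime)
    (hG : ∃ k : ℕ, Nat.card G = p ^ k) (x : G) : ∃ k : ℕ, orderOf x = p ^ k := by
  obtain ⟨k, hk⟩ := hG
  obtain ⟨j, -, hj⟩ := (Nat.dvd_prime_pow hp).1 (hk ▸ orderOf_dvd_natCard x)
  exact ⟨j, hj⟩

theorem exists_mem_zpowers_orderOf_eq {G : Type*} [Group G] [Finite G] {x : G} {n : ℕ}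
    (hn : n ∣ orderOf x) : ∃ y ∈ zpowers x, orderOf y = n :=
  ⟨x ^ (orderOf x / n), npow_mem_zpowers x _, orderOf_pow_orderOf_div (orderOf_pos x).ne' hn⟩

variable {ι : Type*} {p : ι → ℕ} {G : ι → Type*} [∀ i, Group (G i)]

theorem prime_pow_eq_one_of_eq {p q a b : ℕ} (hp : p.Prime) (hq : q.Prime) (hpq : p ≠ q)
    (h : p ^ a = q ^ b) : p ^ a = 1 :=
  Nat.Coprime.eq_one_of_dvd (((Nat.coprime_primes hp hq).2 hpq).pow a b) h.dvd

theorem IsPrimePowerFamily.coprime_card (h : IsPrimePowerFamily p G) {i j : ι} (hij : i ≠ j) :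
    (Nat.card (G i)).Coprime (Nat.card (G j)) := by
  obtain ⟨k, hk⟩ := h.card i
  obtain ⟨l, hl⟩ := h.card j
  rw [hk, hl]
  exact ((Nat.coprime_primes (h.prime i) (h.prime j)).2 fun e => hij (h.inj e)).pow k l

theorem IsPrimePowerFamily.finite (h : IsPrimePowerFamily p G) (i : ι) : Finite (G i) := by
  obtain ⟨k, hk⟩ := h.card i
  exact Nat.finite_of_card_ne_zero (hk ▸ pow_ne_zero k (h.prime i).ne_zero)

theorem IsPrimePowerFamily.orderOf_eq (h : IsPrimePowerFamily p G) {i : ι} (x : G i) :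
    ∃ k : ℕ, orderOf x = p i ^ k :=
  exists_orderOf_eq_prime_pow_of_card (h.prime i) (h.card i) x

/-- Exponents chosen separately in the components can be replaced by one common exponent, because
the moduli `Nat.card (G i)` are pairwise coprime. -/
theorem IsPrimePowerFamily.mem_zpowers_iff [Fintype ι] (h : IsPrimePowerFamily p G)
    (x y : ∀ i, G i) : y ∈ zpowers x ↔ ∀ i, y i ∈ zpowers (x i) := by
  have hfin := h.finite
  constructor
  · rintro ⟨m, rfl⟩ i
    exact ⟨m, rfl⟩
  · intro hy
    have hk : ∀ i, ∃ k : ℕ, x i ^ k = y i := fun i => by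
      obtain ⟨k, hk⟩ := mem_powers_iff_mem_zpowers.2 (hy i)
      exact ⟨k, hk⟩
    choose k hk using hk
    obtain ⟨m, hm⟩ := Nat.chineseRemainderOfFinset k (fun i => Nat.card (G i)) Finset.univ
      (fun i _ => Nat.card_pos.ne') (fun i _ j _ hij => h.coprime_card hij)
    refine mem_powers_iff_mem_zpowers.1 ⟨m, funext fun i => ?_⟩
    show x i ^ m = y i
    rw [← hk i]
    exact pow_eq_pow_iff_modEq.2 ((hm i (Finset.mem_univ i)).of_dvd (orderOf_dvd_natCard (x i)))

theorem IsPrimePowerFamily.orderOf_pi [Fintype ι] (h : IsPrimePowerFamily p G) (x : ∀ i, G i) :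
    orderOf x = ∏ i, orderOf (x i) := by
  rw [Pi.orderOf, Finset.lcm_eq_prod]
  exact fun i _ j _ hij => Nat.Coprime.of_dvd (orderOf_dvd_natCard _) (orderOf_dvd_natCard _)
    (h.coprime_card hij)

variable [DecidableEq ι]

theorem orderOf_piMulSingle (i : ι) (a : G i) :
    orderOf (Pi.mulSingle i a : ∀ i, G i) = orderOf a :=
  orderOf_injective (MonoidHom.mulSingle G i) (Pi.mulSingle_injective i) a

theorem IsPrimePowerFamily.mulSingle_mem_zpowers_iff [Fintype ι] (h : IsPrimePowerFamily p G)
    (i : ι) (a : G i) (x : ∀ i, G i) : Pi.mulSingle i a ∈ zpowers x ↔ a ∈ zpowers (x i) := by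
  rw [h.mem_zpowers_iff]
  refine ⟨fun hx => by simpa using hx i, fun hx j => ?_⟩
  rcases eq_or_ne j i with rfl | hj
  · simpa using hx
  · simp [Pi.mulSingle_eq_of_ne hj, one_mem]

/-- For `j ≠ i` the order of `x j` is a power of `p j` that divides a power of `p i`, so it is `1`.
-/
theorem IsPrimePowerFamily.eq_mulSingle (h : IsPrimePowerFamily p G) (i : ι) {x : ∀ i, G i}
    {k : ℕ} (hx : orderOf x = p i ^ k) : x = Pi.mulSingle i (x i) := by
  funext j
  rcases eq_or_ne j i with rfl | hj
  · simp
  · rw [Pi.mulSingle_eq_of_ne hj]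
    obtain ⟨l, hl⟩ := h.orderOf_eq (x j)
    have hd : orderOf (x j) ∣ p i ^ k := hx ▸ orderOf_apply_dvd_orderOf j
    obtain ⟨m, -, hm⟩ := (Nat.dvd_prime_pow (h.prime i)).1 hd
    rw [← orderOf_eq_one_iff, hl]
    exact prime_pow_eq_one_of_eq (h.prime j) (h.prime i) (fun e => hj (h.inj e)) (hl.symm.trans hm)

end Family

/-! ## Presentations of coloured digraphs by groups -/

section Presentation

variable {V W : Type*}

/-- `u` equals `v` or `v` has an edge to `u`. -/
def ColDigraph.Below (C : ColDigraph V) (u v : V) : Prop := u = v ∨ C.Adj v u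

/-- The map `c` turns the relation `y ∈ ⟨x⟩` and the order of elements into the edges and colours
of `C`. -/
structure Presents {G : Type*} [Group G] (C : ColDigraph V) (c : G → V) : Prop where
  below : ∀ x y, C.Below (c y) (c x) ↔ y ∈ zpowers x
  col : ∀ x, C.col (c x) = orderOf x

theorem ColDigraph.Below.refl {C : ColDigraph V} (u : V) : C.Below u u := Or.inl rfl

section Basic

variable {G : Type*} [Group G] {C : ColDigraph V} {D : ColDigraph W} {c : G → V} {d : G → W}

theorem dpow_adj_iff [Finite G] (x y : G) : (dpow G).Adj x y ↔ y ∈ zpowers x := by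
  constructor
  · rintro ⟨m, -, rfl⟩
    exact npow_mem_zpowers x m
  · intro hy
    obtain ⟨m, rfl⟩ := mem_powers_iff_mem_zpowers.2 hy
    exact ⟨m + orderOf x, Nat.add_pos_right _ (orderOf_pos x),
      by simp [pow_add, pow_orderOf_eq_one]⟩

theorem pcls_eq_iff [Finite G] (x y : G) : pcls x = pcls y ↔ zpowers x = zpowers y := by
  rw [pcls, pcls, cls, cls, Quotient.eq]
  show closedOut (dpow G) x = closedOut (dpow G) y ↔ _
  rw [closedOut_dpow, closedOut_dpow]
  simp only [dpow_adj_iff]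
  exact SetLike.coe_set_eq (p := zpowers x) (q := zpowers y)

/-- An edge between classes is witnessed by arbitrary members, but all members of a class generate
the same subgroup, so the representatives do not matter. -/
theorem presents_pcls [Finite G] : Presents (rdpow G) (pcls (G := G)) where
  below x y := by
    constructor
    · rintro (h | ⟨-, x', y', hx, hy, h⟩)
      · rw [pcls_eq_iff] at h
        exact h ▸ mem_zpowers y
      · rw [dpow_adj_iff] at h
        have hx' := (pcls_eq_iff x' x).1 hx
        have hy' := (pcls_eq_iff y' y).1 hy
        rw [← hx']
        exact zpowers_le.2 h (hy' ▸ mem_zpowers y)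
    · intro h
      rcases eq_or_ne (pcls y) (pcls x) with e | e
      · exact Or.inl e
      · exact Or.inr ⟨e.symm, x, y, rfl, rfl, (dpow_adj_iff x y).2 h⟩
  col := col_pcls

theorem pcls_surjective : Function.Surjective (pcls (G := G)) := Quotient.mk_surjective

theorem rdpow_irrefl (v : TwinClass (dpow G)) : ¬ (rdpow G).Adj v v := fun h => h.1 rfl

theorem Presents.below_antisymm (h : Presents C c) [Finite G] {x y : G}
    (hxy : C.Below (c x) (c y)) (hyx : C.Below (c y) (c x)) : zpowers x = zpowers y :=
  le_antisymm (zpowers_le.2 ((h.below _ _).1 hxy)) (zpowers_le.2 ((h.below _ _).1 hyx))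

/-- In a presented graph, `c` takes the same value on elements that generate the same subgroup,
provided that the graph is antisymmetric. -/
theorem Presents.eq_iff (h : Presents C c) [Finite G]
    (hC : ∀ u v, C.Below u v → C.Below v u → u = v) (x y : G) :
    c x = c y ↔ zpowers x = zpowers y := by
  constructor
  · intro e
    exact h.below_antisymm (e ▸ .refl _) (e ▸ .refl _)
  · intro e
    exact hC _ _ ((h.below _ _).2 (e ▸ mem_zpowers x)) ((h.below _ _).2 (e ▸ mem_zpowers y))

theorem ColIso.map_below (F : ColIso C D) (u v : V) :
    D.Below (F u) (F v) ↔ C.Below u v :=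
  or_congr F.toEquiv.injective.eq_iff (F.map_adj v u)

theorem Presents.comp_iso (h : Presents C c) (F : ColIso C D) : Presents D (fun x => F (c x)) where
  below x y := (F.map_below _ _).trans (h.below x y)
  col x := (F.map_col _).trans (h.col x)

theorem adj_iff_below (hC : ∀ v, ¬ C.Adj v v) (u v : V) : C.Adj v u ↔ C.Below u v ∧ u ≠ v := by
  constructor
  · intro h
    exact ⟨Or.inr h, by rintro rfl; exact hC _ h⟩
  · rintro ⟨rfl | h, h'⟩
    · exact absurd rfl h'
    · exact h

/-- Two surjections from one set with the same fibres identify their targets. The set `U` carries no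
group structure here, since it is also taken to be a set of vertices in `IsReducedDigraph.comap`. -/
theorem exists_colIso {U : Type*} {c : U → V} {d : U → W}
    (hcs : Function.Surjective c) (hds : Function.Surjective d)
    (heq : ∀ x y, c x = c y ↔ d x = d y)
    (hadj : ∀ x y, D.Adj (d x) (d y) ↔ C.Adj (c x) (c y))
    (hcol : ∀ x, D.col (d x) = C.col (c x)) :
    ∃ F : ColIso C D, ∀ x, F (c x) = d x := by
  let f : V → W := fun v => d (Function.surjInv hcs v)
  have hf : ∀ x, f (c x) = d x := fun x => (heq _ _).1 (Function.surjInv_eq hcs (c x))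
  have hb : Function.Bijective f := by
    refine ⟨fun u v => ?_, fun w => ?_⟩
    · obtain ⟨x, rfl⟩ := hcs u
      obtain ⟨y, rfl⟩ := hcs v
      rw [hf, hf]
      exact (heq x y).2
    · obtain ⟨x, rfl⟩ := hds w
      exact ⟨c x, hf x⟩
  refine ⟨⟨Equiv.ofBijective f hb, fun u v => ?_, fun u => ?_⟩, hf⟩
  · obtain ⟨x, rfl⟩ := hcs u
    obtain ⟨y, rfl⟩ := hcs v
    show D.Adj (f _) (f _) ↔ _
    rw [hf, hf, hadj]
  · obtain ⟨x, rfl⟩ := hcs u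
    show D.col (f _) = _
    rw [hf, hcol]

/-- Antisymmetry makes the fibres of `c` and `d` the sets of generators of the cyclic subgroups, and
the absence of loops recovers adjacency from `Below`. Hence the group alone determines the graph. -/
theorem Presents.exists_colIso [Finite G] (hc : Presents C c) (hd : Presents D d)
    (hcs : Function.Surjective c) (hds : Function.Surjective d)
    (hC : ∀ v, ¬ C.Adj v v) (hD : ∀ v, ¬ D.Adj v v)
    (hCa : ∀ u v, C.Below u v → C.Below v u → u = v)
    (hDa : ∀ u v, D.Below u v → D.Below v u → u = v) :
    ∃ F : ColIso C D, ∀ x, F (c x) = d x := by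
  have key : ∀ x y, c x = c y ↔ d x = d y := fun x y => by
    rw [hc.eq_iff hCa, hd.eq_iff hDa]
  refine PowRec.exists_colIso hcs hds key (fun x y => ?_) fun x => by rw [hc.col, hd.col]
  rw [adj_iff_below hC, adj_iff_below hD, hc.below, hd.below, Ne, Ne, key]

end Basic

theorem rdpow_antisymm {G : Type*} [Group G] [Finite G] (u v : TwinClass (dpow G))
    (h : (rdpow G).Below u v) (h' : (rdpow G).Below v u) : u = v := by
  obtain ⟨x, rfl⟩ := pcls_surjective u
  obtain ⟨y, rfl⟩ := pcls_surjective v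
  rw [pcls_eq_iff]
  exact presents_pcls.below_antisymm h h'

end Presentation

/-! ### Gluing isomorphisms of the primary parts -/

section Glue

variable {V W : Type*}

theorem part_below (C : ColDigraph V) (p : ℕ) (u v : {v : V // ∃ k : ℕ, C.col v = p ^ k}) :
    (C.part p).Below u v ↔ C.Below u.1 v.1 :=
  or_congr Subtype.ext_iff Iff.rfl

variable {ι : Type} [Fintype ι] {p : ι → ℕ} {G H : ι → Type} [∀ i, Group (G i)] [∀ i, Group (H i)]
  [∀ i, Finite (G i)] [∀ i, Finite (H i)]

open Classical in
theorem IsPrimePowerFamily.exists_singleVertex (hF : IsPrimePowerFamily p G) (i : ι)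
    (v : {v : TwinClass (dpow (∀ i, G i)) // ∃ k : ℕ, (rdpow (∀ i, G i)).col v = p i ^ k}) :
    ∃ a, v = singleVertex (hF.prime i) G i (hF.card i) a := by
  obtain ⟨v, k, hk⟩ := v
  obtain ⟨z, rfl⟩ := pcls_surjective v
  rw [col_pcls] at hk
  exact ⟨z i, Subtype.ext (congrArg pcls (hF.eq_mulSingle i hk))⟩

-- The equivalence in the last clause packs existence and uniqueness of the least common parent
-- together with its identification as the image of `[x]`.
open Classical in
theorem IsPrimePowerFamily.glue (hG : IsPrimePowerFamily p G) (hH : IsPrimePowerFamily p H)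
    (f : ∀ i, ColIso ((rdpow (∀ j, H j)).part (p i)) ((rdpow (∀ j, G j)).part (p i))) :
    ∃ F : ColIso (rdpow (∀ j, H j)) (rdpow (∀ j, G j)),
      (∀ i v, F v.1 = (f i v).1) ∧
      ∀ (x : ∀ j, H j) (w : TwinClass (dpow (∀ j, G j))),
        IsLeastCommonParent (rdpow (∀ j, G j))
          (fun i => (f i (singleVertex (hH.prime i) H i (hH.card i) (x i))).1) w ↔
        w = F (pcls x) := by
  -- Every vertex of a primary part comes from a single component, so `f i` lifts to a choice of
  -- elements of `G i`.
  choose g hg using fun i a =>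
    hG.exists_singleVertex i (f i (singleVertex (hH.prime i) H i (hH.card i) a))
  have hpow : ∀ i a b, g i b ∈ zpowers (g i a) ↔ b ∈ zpowers a := by
    intro i a b
    have h := (f i).map_below (singleVertex (hH.prime i) H i (hH.card i) b)
      (singleVertex (hH.prime i) H i (hH.card i) a)
    rw [hg, hg, part_below, part_below] at h
    have h' := (presents_pcls.below _ _).symm.trans (h.trans (presents_pcls.below _ _))
    rw [hG.mulSingle_mem_zpowers_iff, hH.mulSingle_mem_zpowers_iff] at h'
    simpa using h'
  have hord : ∀ i a, orderOf (g i a) = orderOf a := by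
    intro i a
    have h : (rdpow (∀ j, G j)).col (f i (singleVertex (hH.prime i) H i (hH.card i) a)).1 =
      (rdpow (∀ j, H j)).col (singleVertex (hH.prime i) H i (hH.card i) a).1 := (f i).map_col _
    rw [hg] at h
    have h' := (col_pcls _).symm.trans (h.trans (col_pcls _))
    rwa [orderOf_piMulSingle, orderOf_piMulSingle] at h'
  -- Needed for `F` to extend `f i`: the trivial components of an element concentrated in `H i` must
  -- stay trivial.
  have hg1 : ∀ i, g i 1 = 1 := fun i => by
    rw [← orderOf_eq_one_iff, hord, orderOf_one]
  have hd : Presents (rdpow (∀ j, G j)) (fun x : ∀ j, H j => pcls fun i => g i (x i)) := by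
    refine ⟨fun x y => ?_, fun x => ?_⟩
    · rw [presents_pcls.below, hG.mem_zpowers_iff, hH.mem_zpowers_iff]
      exact forall_congr' fun i => hpow i _ _
    · rw [col_pcls, hG.orderOf_pi, hH.orderOf_pi]
      exact Finset.prod_congr rfl fun i _ => hord i _
  have hds : Function.Surjective fun x : ∀ j, H j => pcls fun i => g i (x i) := by
    intro w
    obtain ⟨z, rfl⟩ := pcls_surjective w
    have : ∀ i, ∃ a, zpowers (g i a) = zpowers (z i) := by
      intro i
      obtain ⟨u, hu⟩ := (f i).toEquiv.surjective (singleVertex (hG.prime i) G i (hG.card i) (z i))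
      obtain ⟨a, rfl⟩ := hH.exists_singleVertex i u
      have h := congrArg Subtype.val ((hg i a).symm.trans hu)
      have h' := (pcls_eq_iff _ _).1 h
      refine ⟨a, le_antisymm (zpowers_le.2 ?_) (zpowers_le.2 ?_)⟩
      · have := (hG.mulSingle_mem_zpowers_iff i (g i a) _).1 (h' ▸ mem_zpowers _)
        simpa using this
      · have := (hG.mulSingle_mem_zpowers_iff i (z i) _).1 (h'.symm ▸ mem_zpowers _)
        simpa using this
    choose a ha using this
    refine ⟨a, (pcls_eq_iff _ _).2 (le_antisymm (zpowers_le.2 ?_) (zpowers_le.2 ?_))⟩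
    · exact (hG.mem_zpowers_iff _ _).2 fun i => ha i ▸ mem_zpowers _
    · exact (hG.mem_zpowers_iff _ _).2 fun i => (ha i).symm ▸ mem_zpowers _
  obtain ⟨F, hF⟩ := (presents_pcls (G := ∀ j, H j)).exists_colIso hd pcls_surjective hds
    rdpow_irrefl rdpow_irrefl rdpow_antisymm rdpow_antisymm
  refine ⟨F, fun i v => ?_, fun x w => ?_⟩
  · obtain ⟨a, rfl⟩ := hH.exists_singleVertex i v
    rw [hg]
    refine (hF _).trans (congrArg pcls (funext fun j => ?_))
    rcases eq_or_ne j i with rfl | hj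
    · simp
    · simp [Pi.mulSingle_eq_of_ne hj, hg1]
  · rw [hF]
    have hcp : ∀ z : ∀ j, G j, IsCommonParent (rdpow (∀ j, G j))
        (fun i => (f i (singleVertex (hH.prime i) H i (hH.card i) (x i))).1) (pcls z) ↔
        (fun i => g i (x i)) ∈ zpowers z := by
      intro z
      rw [hG.mem_zpowers_iff]
      refine forall_congr' fun i => ?_
      dsimp only
      rw [hg, ← hG.mulSingle_mem_zpowers_iff, ← presents_pcls.below]
      exact or_congr_left eq_comm
    constructor
    · obtain ⟨z, rfl⟩ := pcls_surjective w
      rintro ⟨h1, h2⟩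
      rw [hcp] at h1
      have h3 := h2 _ ((hcp _).2 (mem_zpowers _))
      rw [col_pcls, col_pcls] at h3
      -- The cyclic group of a common parent contains the one generated by `(g i (x i))`; minimality
      -- of the colour bounds its order from above, so the two coincide.
      refine (pcls_eq_iff _ _).2 (Subgroup.eq_of_le_of_card_ge (zpowers_le.2 h1) ?_).symm
      rwa [Nat.card_zpowers, Nat.card_zpowers]
    · rintro rfl
      refine ⟨(hcp _).2 (mem_zpowers _), fun w' hw' => ?_⟩
      obtain ⟨z, rfl⟩ := pcls_surjective w'
      rw [hcp] at hw'
      rw [col_pcls, col_pcls]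
      exact Nat.le_of_dvd (orderOf_pos z) (orderOf_dvd_of_mem_zpowers hw')

end Glue

/-! ## Finite nilpotent groups as products -/

section Nilpotent

variable {X : (G : Type) → [Group G] → Prop}

theorem Nil.exists_family {H : Type} [Group H] (h : Nil X H) :
    ∃ (ι : Type) (_ : Fintype ι) (p : ι → ℕ) (G : ι → Type) (_ : ∀ i, Group (G i)),
      IsPrimePowerFamily p G ∧ (∀ i, X (G i)) ∧ Nonempty ((∀ i, G i) ≃* H) := by
  obtain ⟨hfin, hnil, hsyl⟩ := h
  have hp : ∀ q : (Nat.card H).primeFactors, (q : ℕ).Prime := fun q =>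
    Nat.prime_of_mem_primeFactors q.2
  have hnorm : ∀ (p : ℕ) (_ : Fact p.Prime) (P : Sylow p H), (P : Subgroup H).Normal :=
    (Group.isNilpotent_of_finite_tfae (G := H)).out 0 3 |>.1 hnil
  let P : ∀ q : (Nat.card H).primeFactors, Sylow (q : ℕ) H := fun _ => default
  refine ⟨(Nat.card H).primeFactors, inferInstance, fun q => q, fun q => P q,
    fun q => inferInstance, ⟨hp, Subtype.val_injective, fun q => ?_⟩, fun q => ?_, ⟨?_⟩⟩
  · have := Fact.mk (hp q)
    exact (IsPGroup.iff_card).1 (P q).isPGroup'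
  · exact hsyl q (hp q) (Nat.dvd_of_mem_primeFactors q.2) (P q)
  -- The Mathlib decomposition has, for each prime, a product over all Sylow subgroups. By normality
  -- there is only one, so the inner product collapses to `P q`.
  · refine MulEquiv.trans ?_ (Sylow.directProductOfNormal fun {p hp} P => hnorm p hp P)
    refine MulEquiv.piCongrRight fun q => MulEquiv.symm ?_
    have := Fact.mk (hp q)
    letI := Sylow.unique_of_normal (P q) (hnorm q this (P q))
    exact MulEquiv.piUnique (fun Q : Sylow (q : ℕ) H => Q)

/-- The copy of `G i` in the product lies in some Sylow `p i`-subgroup and exhausts it, as all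
elements of `p i`-power order are concentrated in component `i`. All Sylow subgroups for one prime
are isomorphic, and closure of `X` under isomorphism does the rest. -/
theorem IsPrimePowerFamily.nil_pi {ι : Type} [Fintype ι] {p : ι → ℕ} {G : ι → Type}
    [∀ i, Group (G i)] (hG : IsPrimePowerFamily p G) (hX : ∀ i, X (G i))
    (hiso : ∀ (G H : Type) [Group G] [Group H], Nonempty (G ≃* H) → X G → X H) :
    Nil X (∀ i, G i) := by
  classical
  have hfin := hG.finite
  have hnil : ∀ i, Group.IsNilpotent (G i) := fun i => by
    have := Fact.mk (hG.prime i)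
    exact (IsPGroup.iff_card.2 (hG.card i)).isNilpotent
  refine ⟨inferInstance, inferInstance, fun q hq hdvd P => ?_⟩
  rw [Nat.card_pi, hq.prime.dvd_finsetProd_iff] at hdvd
  obtain ⟨i, -, hi⟩ := hdvd
  obtain ⟨k, hk⟩ := hG.card i
  rw [hk] at hi
  obtain rfl := (Nat.prime_dvd_prime_iff_eq hq (hG.prime i)).1 (hq.dvd_of_dvd_pow hi)
  have := Fact.mk hq
  have e := MonoidHom.ofInjective (f := MonoidHom.mulSingle G i) (Pi.mulSingle_injective i)
  obtain ⟨Q, hQ⟩ := IsPGroup.exists_le_sylow (p := p i) (P := (MonoidHom.mulSingle G i).range)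
    (IsPGroup.iff_card.2 ⟨k, by rw [← Nat.card_congr e.toEquiv, hk]⟩)
  have hQ' : (Q : Subgroup (∀ i, G i)) = (MonoidHom.mulSingle G i).range := by
    refine le_antisymm (fun x hx => ?_) hQ
    obtain ⟨l, hl⟩ := IsPGroup.iff_orderOf.1 Q.isPGroup' ⟨x, hx⟩
    rw [Subgroup.orderOf_mk] at hl
    exact ⟨x i, (hG.eq_mulSingle i hl).symm⟩
  exact hiso _ _ ⟨e.trans ((MulEquiv.subgroupCongr hQ'.symm).trans (Q.equiv P))⟩ (hX i)

end Nilpotent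

/-! ## The reduction to groups of prime power order -/

section Reduction

variable {V W : Type*}

/-- The graph induced on the vertices `e w`. -/
def ColDigraph.comap (C : ColDigraph V) (e : W → V) : ColDigraph W where
  Adj u v := C.Adj (e u) (e v)
  col u := C.col (e u)

theorem ColDigraph.comap_below {C : ColDigraph V} {e : W → V} (he : Function.Injective e)
    (u v : W) : (C.comap e).Below u v ↔ C.Below (e u) (e v) :=
  or_congr he.eq_iff.symm Iff.rfl

/-- A vertex of colour different from `1` such that all other vertices below it have colour `1`. -/
def ColDigraph.Atom (C : ColDigraph V) (a : V) : Prop :=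
  C.col a ≠ 1 ∧ ∀ u, C.Below u a → u = a ∨ C.col u = 1

/-- Every vertex below `v` of colour different from `1` is above a vertex of colour `p`. -/
def ColDigraph.Primary (C : ColDigraph V) (p : ℕ) (v : V) : Prop :=
  ∀ u, C.Below u v → C.col u = 1 ∨ ∃ w, C.Below w u ∧ C.col w = p

/-- The conditions that make a coloured digraph the product of its primary parts. -/
structure ColDigraph.IsProductLike (C : ColDigraph V) : Prop where
  trans : ∀ u v w, C.Below u v → C.Below v w → C.Below u w
  antisymm : ∀ u v, C.Below u v → C.Below v u → u = v
  bot : ∃ e, C.col e = 1 ∧ ∀ z, C.Below z e → C.col z = 1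
  separated : ∀ u v, (∀ a, C.Atom a → ∀ z, C.Below z u → C.Primary (C.col a) z → C.Below z v) →
    C.Below u v
  component : ∀ a, C.Atom a → ∀ v, ∃ m, C.Below m v ∧ C.Primary (C.col a) m ∧
    ∀ z, C.Below z v → C.Primary (C.col a) z → C.Below z m
  join : ∀ v w, (∀ a b, C.Atom a → C.Atom b → C.Below a v → C.Below b w → C.col a ≠ C.col b) →
    ∃ u, C.Below v u ∧ C.Below w u ∧ C.col u = C.col v * C.col w ∧
      ∀ a, C.Atom a → ∀ z, C.Primary (C.col a) z → C.Below z u → C.Below z v ∨ C.Below z w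

/-- The graph induced on the primary vertices for `p`. -/
def ColDigraph.primaryPart (C : ColDigraph V) (p : ℕ) : ColDigraph {v // C.Primary p v} :=
  C.comap Subtype.val

/-- This trades isomorphisms with a quotient graph for maps defined on group elements, which are
easier to restrict to subgroups and to combine over products. -/
theorem isRDPowOf_iff {X : (G : Type) → [Group G] → Prop}
    (hX : ∀ (G : Type) [Group G], X G → Finite G) {C : ColDigraph V} :
    IsRDPowOf X C ↔ (∀ v, ¬ C.Adj v v) ∧ (∀ u v, C.Below u v → C.Below v u → u = v) ∧
      ∃ (G : Type) (_ : Group G) (c : G → V), X G ∧ Function.Surjective c ∧ Presents C c := by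
  constructor
  · rintro ⟨G, _, hG, ⟨F⟩⟩
    have := hX G hG
    refine ⟨fun v => ?_, fun u v => ?_, G, _, fun x => F (pcls x), hG,
      F.toEquiv.surjective.comp pcls_surjective, presents_pcls.comp_iso F⟩
    · obtain ⟨v, rfl⟩ := F.toEquiv.surjective v
      exact fun h => rdpow_irrefl v ((F.map_adj v v).1 h)
    · obtain ⟨u, rfl⟩ := F.toEquiv.surjective u
      obtain ⟨v, rfl⟩ := F.toEquiv.surjective v
      exact fun h h' => congrArg _ (rdpow_antisymm u v ((F.map_below u v).1 h)
        ((F.map_below v u).1 h'))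
  · rintro ⟨hi, ha, G, _, c, hG, hs, hc⟩
    have := hX G hG
    obtain ⟨F, -⟩ := presents_pcls.exists_colIso hc pcls_surjective hs rdpow_irrefl hi
      rdpow_antisymm ha
    exact ⟨G, _, hG, ⟨F⟩⟩

theorem finite_of_card_eq_prime_pow {X : (G : Type) → [Group G] → Prop}
    (hpp : ∀ (G : Type) [Group G], X G → ∃ p k : ℕ, p.Prime ∧ Nat.card G = p ^ k)
    (G : Type) [Group G] (hG : X G) : Finite G := by
  obtain ⟨p, k, hp, hk⟩ := hpp G hG
  exact Nat.finite_of_card_ne_zero (hk ▸ pow_ne_zero k hp.ne_zero)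

variable {C : ColDigraph V} {X : (G : Type) → [Group G] → Prop}

/-- If the primary part that belongs to an atom `a` is presented by a group of prime power order,
then the prime is the colour of `a`. -/
theorem ColDigraph.Atom.exists_presents {a : V} (ha : C.Atom a)
    (hpp : ∀ (G : Type) [Group G], X G → ∃ p k : ℕ, p.Prime ∧ Nat.card G = p ^ k)
    (h : IsRDPowOf X (C.primaryPart (C.col a))) :
    (C.col a).Prime ∧ ∃ (G : Type) (_ : Group G) (c : G → V), X G ∧
      (∃ k : ℕ, Nat.card G = C.col a ^ k) ∧ (∀ v, C.Primary (C.col a) v ↔ ∃ x, c x = v) ∧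
      Presents C c := by
  have hfin := finite_of_card_eq_prime_pow hpp
  obtain ⟨-, -, G, _, c, hG, hs, hc⟩ := (isRDPowOf_iff hfin).1 h
  have := hfin G hG
  obtain ⟨d, hr, hd⟩ : ∃ d : G → V, (∀ v, C.Primary (C.col a) v ↔ ∃ x, d x = v) ∧
      Presents C d := by
    refine ⟨fun x => (c x).1, fun v => ⟨fun hv => ?_, ?_⟩,
      fun x y => (ColDigraph.comap_below Subtype.val_injective _ _).symm.trans (hc.below x y), hc.col⟩
    · obtain ⟨x, hx⟩ := hs ⟨v, hv⟩
      exact ⟨x, congrArg _ hx⟩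
    · rintro ⟨x, rfl⟩
      exact (c x).2
  obtain ⟨p, k, hp, hk⟩ := hpp G hG
  have hpa : C.col a = p := by
    obtain ⟨x, rfl⟩ := (hr a).1 fun u hu =>
      (ha.2 u hu).elim (fun e => Or.inr ⟨u, .refl u, e ▸ rfl⟩) Or.inl
    obtain ⟨j, hj⟩ := exists_orderOf_eq_prime_pow_of_card hp ⟨k, hk⟩ x
    have hx : orderOf x ≠ 1 := by rw [← hd.col]; exact ha.1
    -- The atom is the class of a nontrivial `x`, and `zpowers x` contains an element of order `p`.
    -- Its vertex lies below the atom and has colour `p ≠ 1`, so it is the atom itself.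
    have hj0 : j ≠ 0 := by rintro rfl; exact hx (by simpa using hj)
    obtain ⟨y, hy, hyp⟩ := exists_mem_zpowers_orderOf_eq (hj ▸ dvd_pow_self p hj0)
    rcases ha.2 _ ((hd.below x y).2 hy) with e | e
    · rw [← e, hd.col, hyp]
    · rw [hd.col, hyp] at e
      exact absurd e hp.one_lt.ne'
  exact ⟨hpa ▸ hp, G, _, d, hG, ⟨k, hpa ▸ hk⟩, hr, hd⟩

/-- The groups for the primary parts are multiplied together. The axiom `join` yields a vertex for
every tuple of elements, `component` shows that every vertex arises in this way, and `separated`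
says that a vertex is determined by the primary vertices below it. -/
theorem ColDigraph.IsProductLike.isRDPowOf_nil [Finite V] (hC : C.IsProductLike)
    (hirr : ∀ v, ¬ C.Adj v v)
    (hpp : ∀ (G : Type) [Group G], X G → ∃ p k : ℕ, p.Prime ∧ Nat.card G = p ^ k)
    (hiso : ∀ (G H : Type) [Group G] [Group H], Nonempty (G ≃* H) → X G → X H)
    (h : ∀ a, C.Atom a → IsRDPowOf X (C.primaryPart (C.col a))) :
    IsRDPowOf (Nil X) C := by
  classical
  -- The index set consists of the colours of atoms and not of the atoms, since different subgroups
  -- of order `p` give different atoms but belong to one Sylow factor.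
  let ι : Type := {p : ℕ // ∃ a, C.Atom a ∧ C.col a = p}
  have : Finite ι := by
    refine (Set.finite_range C.col).subset ?_ |>.to_subtype
    rintro p ⟨a, -, rfl⟩
    exact ⟨a, rfl⟩
  have := Fintype.ofFinite ι
  have key : ∀ i : ι, i.1.Prime ∧ ∃ (G : Type) (_ : Group G) (c : G → V), X G ∧
      (∃ k : ℕ, Nat.card G = i.1 ^ k) ∧ (∀ v, C.Primary i.1 v ↔ ∃ x, c x = v) ∧
      Presents C c := by
    rintro ⟨p, a, ha, rfl⟩
    exact ha.exists_presents hpp (h a ha)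
  choose hprime G hgrp c hX hcard hr hc using key
  have hG : IsPrimePowerFamily (fun i : ι => i.1) G := ⟨hprime, Subtype.val_injective, hcard⟩
  have hfin := hG.finite
  -- a vertex in two primary parts has colour `1`
  have hinter : ∀ (i j : ι) (z : V), i ≠ j → C.Primary i.1 z → C.Primary j.1 z →
      C.col z = 1 := by
    intro i j z hij hi hj
    obtain ⟨x, rfl⟩ := (hr i z).1 hi
    obtain ⟨y, hy⟩ := (hr j _).1 hj
    obtain ⟨k, hk⟩ := hG.orderOf_eq x
    obtain ⟨l, hl⟩ := hG.orderOf_eq y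
    have e := (hc j).col y
    rw [hy, (hc i).col] at e
    rw [(hc i).col, hk]
    exact prime_pow_eq_one_of_eq (hprime i) (hprime j) (fun e => hij (Subtype.ext e))
      (hk.symm.trans (e.trans hl))
  have hone : ∀ (i : ι) (z : V) (x : G i), C.Primary i.1 z → C.col z = 1 →
      C.Below z (c i x) := by
    intro i z x hz h1
    obtain ⟨y, rfl⟩ := (hr i z).1 hz
    rw [(hc i).col, orderOf_eq_one_iff] at h1
    exact ((hc i).below _ _).2 (h1 ▸ one_mem _)
  have hprim : ∀ (i : ι) (x : G i), C.Primary i.1 (c i x) := fun i x => (hr i _).2 ⟨x, rfl⟩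
  have hatom : ∀ a, C.Atom a → C.Primary (C.col a) a := fun a ha u hu =>
    (ha.2 u hu).elim (fun e => Or.inr ⟨u, .refl u, e ▸ rfl⟩) Or.inl
  have hacol : ∀ (i : ι) (x : G i) (a : V), C.Atom a → C.Below a (c i x) → C.col a = i.1 := by
    intro i x a ha hax
    have hpa : C.Primary i.1 a := fun u hu => hprim i x u (hC.trans _ _ _ hu hax)
    by_contra hne
    exact ha.1 (hinter ⟨C.col a, a, ha, rfl⟩ i a (fun e => hne (congrArg Subtype.val e))
      (hatom a ha) hpa)
  -- The components are joined one at a time. The last clause keeps track of the primary vertices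
  -- below `u`; it ensures that no atom below `u` has the colour of the next component, as `join`
  -- requires.
  have hjoin : ∀ (x : ∀ i, G i) (s : Finset ι), ∃ u, C.col u = ∏ i ∈ s, orderOf (x i) ∧
      (∀ i ∈ s, C.Below (c i (x i)) u) ∧
      ∀ j z, C.Primary j z → (∃ a, C.Atom a ∧ C.col a = j) → C.Below z u →
        C.col z = 1 ∨ ∃ i ∈ s, C.Below z (c i (x i)) := by
    intro x s
    induction s using Finset.induction_on with
    | empty =>
      obtain ⟨e, he, he'⟩ := hC.bot
      exact ⟨e, by simpa using he, by simp, fun _ z _ _ hz => Or.inl (he' z hz)⟩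
    | insert j s hj ih =>
      obtain ⟨u, hu1, hu2, hu3⟩ := ih
      obtain ⟨w, hw1, hw2, hw3, hw4⟩ := hC.join u (c j (x j)) (by
        intro a b ha hb hau hbj hab
        rcases hu3 _ a (hatom a ha) ⟨a, ha, rfl⟩ hau with h1 | ⟨i, hi, hai⟩
        · exact ha.1 h1
        · have e := (hacol i _ a ha hai).symm.trans (hab.trans (hacol j _ b hb hbj))
          exact hj (Subtype.ext e ▸ hi))
      refine ⟨w, ?_, ?_, ?_⟩
      · rw [hw3, Finset.prod_insert hj, hu1, (hc j).col, mul_comm]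
      · intro i hi
        rcases Finset.mem_insert.1 hi with rfl | hi
        · exact hw2
        · exact hC.trans _ _ _ (hu2 i hi) hw1
      · rintro _ z hz ⟨a, ha, rfl⟩ hzw
        rcases hw4 a ha z hz hzw with h1 | h1
        · exact (hu3 _ z hz ⟨a, ha, rfl⟩ h1).imp_right fun ⟨i, hi, h2⟩ =>
            ⟨i, Finset.mem_insert_of_mem hi, h2⟩
        · exact Or.inr ⟨j, Finset.mem_insert_self j s, h1⟩
  -- Vertices of colour `1` belong to every part, but in each part they are the class of the
  -- identity and lie below everything, so the exceptional case of `hjoin` disappears.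
  have hex : ∀ x : ∀ i, G i, ∃ u, C.col u = orderOf x ∧
      ∀ i z, C.Primary i.1 z → (C.Below z u ↔ C.Below z (c i (x i))) := by
    intro x
    obtain ⟨u, hu1, hu2, hu3⟩ := hjoin x Finset.univ
    refine ⟨u, by rw [hu1, hG.orderOf_pi], fun i z hz => ⟨fun hzu => ?_, fun hz' =>
      hC.trans _ _ _ hz' (hu2 i (Finset.mem_univ i))⟩⟩
    rcases hu3 i.1 z hz i.2 hzu with h1 | ⟨j, -, hj⟩
    · exact hone i z _ hz h1
    · rcases eq_or_ne i j with rfl | hij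
      · exact hj
      · exact hone i z _ hz (hinter i j z hij hz fun u hu =>
          hprim j (x j) u (hC.trans _ _ _ hu hj))
  choose d hd1 hd2 using hex
  have hsep : ∀ u v, (∀ (i : ι) z, C.Primary i.1 z → C.Below z u → C.Below z v) →
      C.Below u v := fun u v huv =>
    hC.separated u v fun a ha z hz hz' => huv ⟨C.col a, a, ha, rfl⟩ z hz' hz
  refine (isRDPowOf_iff fun G _ hG => hG.1).2 ⟨hirr, hC.antisymm, ∀ i, G i, inferInstance, d,
    hG.nil_pi hX hiso, fun v => ?_, fun x y => ?_, hd1⟩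
  -- Surjectivity: the tuple of largest primary vertices below `v` has the same primary vertices
  -- below it as `v`.
  · have : ∀ i : ι, ∃ x : G i, C.Below (c i x) v ∧
        ∀ z, C.Below z v → C.Primary i.1 z → C.Below z (c i x) := by
      rintro ⟨p, a, ha, rfl⟩
      obtain ⟨m, hm1, hm2, hm3⟩ := hC.component a ha v
      obtain ⟨x, rfl⟩ := (hr ⟨C.col a, a, ha, rfl⟩ m).1 hm2
      exact ⟨x, hm1, hm3⟩
    choose x hx1 hx2 using this
    refine ⟨x, hC.antisymm _ _ (hsep _ _ fun i z hz hzx => ?_) (hsep _ _ fun i z hz hzv => ?_)⟩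
    · exact hC.trans _ _ _ ((hd2 x i z hz).1 hzx) (hx1 i)
    · exact (hd2 x i z hz).2 (hx2 i z hzv hz)
  · rw [hG.mem_zpowers_iff]
    constructor
    · intro hyx i
      rw [← (hc i).below, ← hd2 x i _ (hprim i _)]
      exact hC.trans _ _ _ ((hd2 y i _ (hprim i _)).2 (.refl _)) hyx
    · intro hyx
      refine hsep _ _ fun i z hz hzy => (hd2 x i z hz).2 ?_
      exact hC.trans _ _ _ ((hd2 y i z hz).1 hzy) (((hc i).below _ _).2 (hyx i))

/-- The graph of a nilpotent group is like a product of its primary parts, and these parts belong to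
the Sylow subgroups. -/
theorem isProductLike_of_isRDPowOf_nil
    (hpp : ∀ (G : Type) [Group G], X G → ∃ p k : ℕ, p.Prime ∧ Nat.card G = p ^ k)
    (h : IsRDPowOf (Nil X) C) :
    C.IsProductLike ∧ ∀ a, C.Atom a → IsRDPowOf X (C.primaryPart (C.col a)) := by
  classical
  obtain ⟨hirr, hanti, H, _, c', hH, hs', hc'⟩ := (isRDPowOf_iff fun G _ hG => hG.1).1 h
  obtain ⟨ι, _, p, G, _, hG, hX, ⟨e⟩⟩ := hH.exists_family
  have hfin := hG.finite
  obtain ⟨c, hs, hc⟩ : ∃ c : (∀ i, G i) → V, Function.Surjective c ∧ Presents C c := by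
    refine ⟨fun x => c' (e x), hs'.comp e.surjective, fun x y => ?_, fun x => ?_⟩
    · rw [hc'.below]
      exact ⟨fun ⟨m, hm⟩ => ⟨m, e.injective ((map_zpow e x m).trans hm)⟩,
        fun ⟨m, hm⟩ => ⟨m, (map_zpow e x m).symm.trans (congrArg e hm)⟩⟩
    · rw [hc'.col, MulEquiv.orderOf_eq]
  clear hs' hc'
  have hbelow : ∀ x y, C.Below (c y) (c x) ↔ ∀ i, y i ∈ zpowers (x i) := fun x y =>
    (hc.below x y).trans (hG.mem_zpowers_iff x y)
  have hsingle : ∀ i a x, C.Below (c (Pi.mulSingle i a)) (c x) ↔ a ∈ zpowers (x i) :=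
    fun i a x => (hc.below _ _).trans (hG.mulSingle_mem_zpowers_iff i a x)
  have hdvd : ∀ i (a : G i), a ≠ 1 → p i ∣ orderOf a := by
    intro i a ha
    obtain ⟨k, hk⟩ := hG.orderOf_eq a
    rw [hk]
    refine dvd_pow_self _ ?_
    rintro rfl
    exact ha (orderOf_eq_one_iff.1 (by simpa using hk))
  have hprime : ∀ i (x : ∀ i, G i), x i ≠ 1 → ∃ y ∈ zpowers x, orderOf y = p i := fun i x hx =>
    exists_mem_zpowers_orderOf_eq ((hdvd i _ hx).trans (orderOf_apply_dvd_orderOf i))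
  -- If `x j ≠ 1` for some `j ≠ i`, then `zpowers x` contains an element of order `p j`, and no
  -- element of order `p i` lies below that.
  have hprimary : ∀ i x, C.Primary (p i) (c x) ↔ x = Pi.mulSingle i (x i) := by
    intro i x
    constructor
    · intro hx
      funext j
      rcases eq_or_ne j i with rfl | hj
      · simp
      · rw [Pi.mulSingle_eq_of_ne hj]
        by_contra hne
        obtain ⟨y, hy, hyp⟩ := hprime j x hne
        rcases hx _ ((hc.below _ _).2 hy) with h1 | ⟨w, hw, hw'⟩
        · rw [hc.col, hyp] at h1
          exact (hG.prime j).one_lt.ne' h1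
        · obtain ⟨w, rfl⟩ := hs w
          rw [hc.col] at hw'
          have := orderOf_dvd_of_mem_zpowers ((hc.below _ _).1 hw)
          rw [hw', hyp, Nat.prime_dvd_prime_iff_eq (hG.prime i) (hG.prime j)] at this
          exact hj (hG.inj this.symm)
    · intro hx u hu
      obtain ⟨u, rfl⟩ := hs u
      rw [hx, hbelow] at hu
      by_cases hui : u i = 1
      · left
        rw [hc.col, orderOf_eq_one_iff]
        funext j
        rcases eq_or_ne j i with rfl | hj
        · exact hui
        · have := hu j
          rw [Pi.mulSingle_eq_of_ne hj] at this
          simpa using this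
      · right
        obtain ⟨y, hy, hyp⟩ := hprime i u hui
        exact ⟨c y, (hc.below _ _).2 hy, (hc.col y).trans hyp⟩
  have hatom : ∀ i (x : ∀ i, G i), x i ≠ 1 → ∃ a, C.Atom a ∧ C.col a = p i ∧ C.Below a (c x) := by
    intro i x hx
    obtain ⟨y, hy, hyp⟩ := hprime i x hx
    refine ⟨c y, ⟨?_, fun u hu => ?_⟩, (hc.col y).trans hyp, (hc.below _ _).2 hy⟩
    · rw [hc.col, hyp]
      exact (hG.prime i).one_lt.ne'
    · obtain ⟨z, rfl⟩ := hs u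
      rw [hc.below] at hu
      have hz := orderOf_dvd_of_mem_zpowers hu
      rw [hyp, Nat.dvd_prime (hG.prime i)] at hz
      rw [hc.col]
      refine hz.symm.imp_left fun hz => (hc.eq_iff hanti _ _).2 ?_
      refine Subgroup.eq_of_le_of_card_ge (zpowers_le.2 hu) ?_
      rw [Nat.card_zpowers, Nat.card_zpowers, hz, hyp]
  have hcolatom : ∀ a, C.Atom a → ∃ i, C.col a = p i := by
    intro a ha
    obtain ⟨x, rfl⟩ := hs a
    have hx : x ≠ 1 := fun hx => ha.1 (by rw [hc.col, hx, orderOf_one])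
    obtain ⟨i, hi⟩ := Function.ne_iff.1 hx
    obtain ⟨y, hy, hyp⟩ := hprime i x hi
    refine ⟨i, ?_⟩
    rcases ha.2 _ ((hc.below _ _).2 hy) with h1 | h1
    · rw [← h1, hc.col, hyp]
    · rw [hc.col, hyp] at h1
      exact absurd h1 (hG.prime i).one_lt.ne'
  refine ⟨⟨?_, hanti, ⟨c 1, ?_, ?_⟩, ?_, ?_, ?_⟩, ?_⟩
  · intro u v w
    obtain ⟨x, rfl⟩ := hs u
    obtain ⟨y, rfl⟩ := hs v
    obtain ⟨z, rfl⟩ := hs w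
    rw [hc.below, hc.below, hc.below]
    exact fun h h' => zpowers_le.2 h' h
  · rw [hc.col, orderOf_one]
  · intro z hz
    obtain ⟨z, rfl⟩ := hs z
    rw [hc.below, zpowers_one_eq_bot, mem_bot] at hz
    rw [hc.col, hz, orderOf_one]
  · intro u v huv
    obtain ⟨x, rfl⟩ := hs u
    obtain ⟨y, rfl⟩ := hs v
    refine (hbelow _ _).2 fun i => ?_
    by_cases hx : x i = 1
    · rw [hx]
      exact one_mem _
    · obtain ⟨a, ha, hap, -⟩ := hatom i x hx
      rw [← hsingle]
      exact huv a ha _ ((hsingle _ _ _).2 (mem_zpowers _)) (hap ▸ (hprimary _ _).2 (by simp))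
  · intro a ha v
    obtain ⟨i, hi⟩ := hcolatom a ha
    obtain ⟨x, rfl⟩ := hs v
    rw [hi]
    refine ⟨c (Pi.mulSingle i (x i)), (hsingle _ _ _).2 (mem_zpowers _),
      (hprimary _ _).2 (by simp), fun z hz hz' => ?_⟩
    obtain ⟨z, rfl⟩ := hs z
    rw [hprimary] at hz'
    rw [hz', hsingle] at hz ⊢
    simpa using hz
  · intro v w hvw
    obtain ⟨x, rfl⟩ := hs v
    obtain ⟨y, rfl⟩ := hs w
    have hxy : ∀ i, x i = 1 ∨ y i = 1 := by
      intro i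
      by_contra! hne
      obtain ⟨a, ha, hap, hax⟩ := hatom i x hne.1
      obtain ⟨b, hb, hbp, hby⟩ := hatom i y hne.2
      exact hvw a b ha hb hax hby (hap.trans hbp.symm)
    -- Since `x` and `y` have disjoint supports, each component of `x * y` is the one from `x` or
    -- the one from `y`.
    refine ⟨c (x * y), (hbelow _ _).2 fun i => ?_, (hbelow _ _).2 fun i => ?_, ?_, ?_⟩
    · rcases hxy i with h1 | h1 <;> simp [h1, one_mem]
    · rcases hxy i with h1 | h1 <;> simp [h1, one_mem]
    · rw [hc.col, hc.col, hc.col, hG.orderOf_pi, hG.orderOf_pi, hG.orderOf_pi,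
        ← Finset.prod_mul_distrib]
      refine Finset.prod_congr rfl fun i _ => ?_
      rcases hxy i with h1 | h1 <;> simp [h1]
    · intro a ha z hz hzu
      obtain ⟨i, hi⟩ := hcolatom a ha
      obtain ⟨z, rfl⟩ := hs z
      rw [hi, hprimary] at hz
      rw [hz, hsingle] at hzu
      rw [hz, hsingle, hsingle]
      rcases hxy i with h1 | h1
      · right
        simpa [h1] using hzu
      · left
        simpa [h1] using hzu
  · intro a ha
    obtain ⟨i, hi⟩ := hcolatom a ha
    rw [hi]
    refine (isRDPowOf_iff (finite_of_card_eq_prime_pow hpp)).2 ⟨fun v => hirr v.1,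
      fun u v huv hvu => ?_, G i, inferInstance,
      fun a => ⟨c (Pi.mulSingle i a), (hprimary _ _).2 (by simp)⟩, hX i, ?_, fun a b => ?_,
      fun a => ?_⟩
    · exact Subtype.ext (hanti _ _ ((ColDigraph.comap_below Subtype.val_injective _ _).1 huv)
        ((ColDigraph.comap_below Subtype.val_injective _ _).1 hvu))
    · rintro ⟨v, hv⟩
      obtain ⟨x, rfl⟩ := hs v
      exact ⟨x i, Subtype.ext (congrArg c ((hprimary _ _).1 hv).symm)⟩
    · refine (ColDigraph.comap_below Subtype.val_injective _ _).trans ((hsingle _ _ _).trans ?_)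
      simp
    · exact (hc.col _).trans (orderOf_piMulSingle i a)

end Reduction

/-! ### Induced subgraphs of reduced digraphs -/

section Reduced

variable {V W : Type*}

theorem IsReducedDigraph.irrefl {C : ColDigraph V} (h : IsReducedDigraph C) (v : V) :
    ¬ C.Adj v v := by
  obtain ⟨U, -, D, -, ⟨F⟩⟩ := h
  obtain ⟨a, rfl⟩ := F.toEquiv.surjective v
  exact fun h => ((F.map_adj a a).1 h).1 rfl

/-- The subgraph of a reduced digraph that is induced on a set of vertices closed under
out-neighbours is reduced. -/
theorem IsReducedDigraph.comap {C : ColDigraph V} (h : IsReducedDigraph C) {e : W → V}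
    (he : Function.Injective e) (hout : ∀ w v, C.Adj (e w) v → v ∈ Set.range e) :
    IsReducedDigraph (C.comap e) := by
  obtain ⟨U, _, D, hD, ⟨F⟩⟩ := h
  let U' := {x : U // F (cls D x) ∈ Set.range e}
  let D' : Digraph U' := ⟨fun x y => D.Adj x.1 y.1⟩
  have hcls : ∀ x y, cls D x = cls D y ↔ closedOut D x = closedOut D y := fun x y => Quotient.eq
  have hcls' : ∀ x y, cls D' x = cls D' y ↔ closedOut D' x = closedOut D' y :=
    fun x y => Quotient.eq
  have hclosed : ∀ (x : U') (y : U), D.Adj x.1 y → F (cls D y) ∈ Set.range e := by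
    intro x y hxy
    by_cases heq : cls D x.1 = cls D y
    · exact heq ▸ x.2
    · obtain ⟨w, hw⟩ := x.2
      refine hout w _ (hw ▸ (F.map_adj _ _).2 ⟨heq, x.1, y, rfl, rfl, hxy⟩)
  -- No out-neighbour is lost in the restriction. Hence the twin relation and the out-degrees, and
  -- with them the colours, are inherited unchanged.
  have hN : ∀ x : U', closedOut D x.1 = Subtype.val '' closedOut D' x := by
    intro x
    ext y
    constructor
    · rintro (rfl | hy)
      · exact ⟨x, Or.inl rfl, rfl⟩
      · exact ⟨⟨y, hclosed x y hy⟩, Or.inr hy, rfl⟩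
    · rintro ⟨y, rfl | hy, rfl⟩
      · exact Or.inl rfl
      · exact Or.inr hy
  have hdeg : ∀ x : U', outDeg D x.1 = outDeg D' x := by
    intro x
    have : {w | D.Adj x.1 w} = Subtype.val '' {w | D'.Adj x w} := by
      ext y
      constructor
      · exact fun hy => ⟨⟨y, hclosed x y hy⟩, hy, rfl⟩
      · rintro ⟨y, hy, rfl⟩
        exact hy
    rw [outDeg, this, Set.ncard_image_of_injective _ Subtype.val_injective]
    rfl
  have hcl : ∀ x y : U', cls D' x = cls D' y ↔ cls D x.1 = cls D y.1 := by
    intro x y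
    rw [hcls, hcls', hN, hN]
    exact (Set.image_injective.2 Subtype.val_injective).eq_iff.symm
  have hD' : TwinsSameOutDeg D' := by
    intro x y hxy
    rw [← hdeg, ← hdeg]
    exact hD _ _ (by rw [hN, hN, hxy])
  choose d hd using fun x : U' => x.2
  refine ⟨U', inferInstance, D', hD', ?_⟩
  refine (exists_colIso (C := reduced D') (D := C.comap e) (c := cls D') (d := d)
    Quotient.mk_surjective (fun w => ?_) (fun x y => ?_) (fun x y => ?_) fun x => ?_).elim
    fun F' _ => ⟨F'⟩
  · obtain ⟨a, ha⟩ := F.toEquiv.surjective (e w)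
    obtain ⟨x, rfl⟩ := Quotient.mk_surjective a
    exact ⟨⟨x, w, ha.symm⟩, he ((hd _).trans ha)⟩
  · rw [hcl, ← he.eq_iff, hd, hd]
    exact F.toEquiv.injective.eq_iff.symm
  · show C.Adj (e (d x)) (e (d y)) ↔ _
    rw [hd, hd, F.map_adj]
    constructor
    · rintro ⟨hne, a, b, ha, hb, hab⟩
      refine ⟨fun h => hne ((hcl _ _).1 h), ⟨a, ha ▸ x.2⟩, ⟨b, hb ▸ y.2⟩, (hcl _ _).2 ha,
        (hcl _ _).2 hb, hab⟩
    · rintro ⟨hne, a, b, ha, hb, hab⟩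
      exact ⟨fun h => hne ((hcl _ _).2 h), a.1, b.1, (hcl _ _).1 ha, (hcl _ _).1 hb, hab⟩
  · show C.col (e (d x)) = _
    rw [hd, F.map_col]
    have h1 : (reduced D).col (cls D x.1) = outDeg D x.1 :=
      hD _ _ (Quotient.mk_out (s := twinSetoid D) x.1)
    have h2 : (reduced D').col (cls D' x) = outDeg D' x :=
      hD' _ _ (Quotient.mk_out (s := twinSetoid D') x)
    rw [h1, h2, hdeg]

theorem ColIso.isRDPowOf {X : (G : Type) → [Group G] → Prop} {C : ColDigraph V}
    {D : ColDigraph W} (F : ColIso C D) (h : IsRDPowOf X C) : IsRDPowOf X D := by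
  obtain ⟨G, _, hG, ⟨F'⟩⟩ := h
  exact ⟨G, _, hG, ⟨⟨F'.toEquiv.trans F.toEquiv,
    fun u v => (F.map_adj _ _).trans (F'.map_adj u v),
    fun u => (F.map_col _).trans (F'.map_col u)⟩⟩⟩

/-- The subroutine receives the primary part with its vertices renumbered; the order of the
numbering is irrelevant to the answer. -/
theorem isRDPowOf_comap_iff {X : (G : Type) → [Group G] → Prop} {C : ColDigraph V} {e : W → V}
    (he : Function.Injective e) {p : ℕ} (hr : ∀ v, v ∈ Set.range e ↔ C.Primary p v) :
    IsRDPowOf X (C.comap e) ↔ IsRDPowOf X (C.primaryPart p) := by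
  let d : W → {v // C.Primary p v} := fun w => ⟨e w, (hr _).1 ⟨w, rfl⟩⟩
  have hd : Function.Surjective d := fun v =>
    ((hr v.1).2 v.2).imp fun w hw => Subtype.ext hw
  constructor
  · obtain ⟨F, -⟩ := exists_colIso (C := C.comap e) (D := C.primaryPart p)
      Function.surjective_id hd (fun x y => by rw [Subtype.ext_iff]; exact he.eq_iff.symm)
      (fun _ _ => Iff.rfl) (fun _ => rfl)
    exact F.isRDPowOf
  · obtain ⟨F, -⟩ := exists_colIso (C := C.primaryPart p) (D := C.comap e)
      hd Function.surjective_id (fun x y => by rw [Subtype.ext_iff]; exact he.eq_iff)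
      (fun _ _ => Iff.rfl) (fun _ => rfl)
    exact F.isRDPowOf

end Reduced

/-! ## Functions computable in polynomial time by programs without calls -/

section PolyTime

/-- A quantity that is bounded by a polynomial in the size of the input. -/
def PolyBounded (h : Data → ℕ) : Prop := ∃ Q : Polynomial ℕ, ∀ x, h x ≤ Q.eval x.size

theorem polynomial_eval_mono (Q : Polynomial ℕ) {a b : ℕ} (h : a ≤ b) : Q.eval a ≤ Q.eval b := by
  rw [Polynomial.eval_eq_sum, Polynomial.eval_eq_sum]
  exact Finset.sum_le_sum fun i _ => Nat.mul_le_mul_left _ (Nat.pow_le_pow_left h i)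

theorem PolyBounded.mono {h h' : Data → ℕ} (hh : PolyBounded h) (hle : ∀ x, h' x ≤ h x) :
    PolyBounded h' := by
  obtain ⟨Q, hQ⟩ := hh
  exact ⟨Q, fun x => (hle x).trans (hQ x)⟩

theorem PolyBounded.const (n : ℕ) : PolyBounded fun _ => n := ⟨Polynomial.C n, fun x => by simp⟩

theorem PolyBounded.size : PolyBounded Data.size := ⟨Polynomial.X, fun x => by simp⟩

theorem PolyBounded.add {h h' : Data → ℕ} (hh : PolyBounded h) (hh' : PolyBounded h') :
    PolyBounded fun x => h x + h' x := by
  obtain ⟨Q, hQ⟩ := hh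
  obtain ⟨Q', hQ'⟩ := hh'
  exact ⟨Q + Q', fun x => by simpa using Nat.add_le_add (hQ x) (hQ' x)⟩

theorem PolyBounded.mul {h h' : Data → ℕ} (hh : PolyBounded h) (hh' : PolyBounded h') :
    PolyBounded fun x => h x * h' x := by
  obtain ⟨Q, hQ⟩ := hh
  obtain ⟨Q', hQ'⟩ := hh'
  exact ⟨Q * Q', fun x => by simpa using Nat.mul_le_mul (hQ x) (hQ' x)⟩

theorem PolyBounded.eval {h : Data → ℕ} (hh : PolyBounded h) (P : Polynomial ℕ) :
    PolyBounded fun x => P.eval (h x) := by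
  obtain ⟨Q, hQ⟩ := hh
  exact ⟨P.comp Q, fun x => by simpa using polynomial_eval_mono P (hQ x)⟩

theorem PolyBounded.comp {h : Data → ℕ} (hh : PolyBounded h) {g : Data → Data}
    (hg : PolyBounded fun x => (g x).size) : PolyBounded fun x => h (g x) := by
  obtain ⟨Q, hQ⟩ := hh
  exact (hg.eval Q).mono fun x => hQ (g x)

/-- `f` is computed by a program without calls in polynomial time. -/
def IsPolyTime (f : Data → Data) : Prop :=
  ∃ (p : Prog) (T : Data → ℕ), PolyBounded T ∧ ∀ x, (f x).size ≤ T x ∧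
    ∀ S, ∃ t ≤ T x, Eval S p x (f x) t 0

theorem IsPolyTime.polyBounded {f : Data → Data} (hf : IsPolyTime f) :
    PolyBounded fun x => (f x).size := by
  obtain ⟨p, T, hT, h⟩ := hf
  exact hT.mono fun x => (h x).1

theorem Data.one_le_size (x : Data) : 1 ≤ x.size := by
  cases x <;> simp only [Data.size] <;> omega

theorem Data.size_fst_le (x : Data) : x.fst.size ≤ x.size := by
  cases x <;> simp only [Data.size, Data.fst] <;> omega

theorem Data.size_snd_le (x : Data) : x.snd.size ≤ x.size := by
  cases x <;> simp only [Data.size, Data.snd] <;> omega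

theorem PolyBounded.one_add_size : PolyBounded fun x => 1 + x.size :=
  (PolyBounded.const 1).add .size

theorem IsPolyTime.id : IsPolyTime fun x => x :=
  ⟨.id, _, .one_add_size, fun x => ⟨by dsimp only; omega, fun S => ⟨_, le_rfl, .id x⟩⟩⟩

theorem IsPolyTime.leaf : IsPolyTime fun _ => .leaf :=
  ⟨.leaf, _, .one_add_size, fun x => ⟨by simp only [Data.size]; omega, fun S =>
    ⟨_, le_rfl, .leaf x⟩⟩⟩

/-- The time of the second program is polynomial in the size of the intermediate value. This is why
the bound `T` in `IsPolyTime` also controls the size of the output. -/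
theorem IsPolyTime.comp {f g : Data → Data} (hf : IsPolyTime f) (hg : IsPolyTime g) :
    IsPolyTime fun x => f (g x) := by
  have hgb := hg.polyBounded
  obtain ⟨p, T, hT, h⟩ := hf
  obtain ⟨p', T', hT', h'⟩ := hg
  refine ⟨.comp p' p, fun x => 1 + T' x + T (g x), ((PolyBounded.const 1).add hT').add
    (hT.comp hgb), fun x => ⟨(h (g x)).1.trans (by dsimp only; omega), fun S => ?_⟩⟩
  obtain ⟨t, ht, e⟩ := (h (g x)).2 S
  obtain ⟨t', ht', e'⟩ := (h' x).2 S
  exact ⟨1 + t' + t, by dsimp only; omega, .comp e' e⟩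

theorem IsPolyTime.fst {f : Data → Data} (hf : IsPolyTime f) : IsPolyTime fun x => (f x).fst :=
  .comp (f := Data.fst) ⟨.fst, _, .one_add_size, fun x => ⟨x.size_fst_le.trans (by omega),
    fun S => ⟨_, le_rfl, .fst x⟩⟩⟩ hf

theorem IsPolyTime.snd {f : Data → Data} (hf : IsPolyTime f) : IsPolyTime fun x => (f x).snd :=
  .comp (f := Data.snd) ⟨.snd, _, .one_add_size, fun x => ⟨x.size_snd_le.trans (by omega),
    fun S => ⟨_, le_rfl, .snd x⟩⟩⟩ hf

theorem IsPolyTime.node {f g : Data → Data} (hf : IsPolyTime f) (hg : IsPolyTime g) :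
    IsPolyTime fun x => .node (f x) (g x) := by
  obtain ⟨p, T, hT, h⟩ := hf
  obtain ⟨p', T', hT', h'⟩ := hg
  refine ⟨.pair p p', fun x => 1 + T x + T' x, ((PolyBounded.const 1).add hT).add hT',
    fun x => ⟨?_, fun S => ?_⟩⟩
  · have h1 := (h x).1
    have h2 := (h' x).1
    simp only [Data.size]
    omega
  · obtain ⟨t, ht, e⟩ := (h x).2 S
    obtain ⟨t', ht', e'⟩ := (h' x).2 S
    exact ⟨1 + t + t', by dsimp only; omega, .pair e e'⟩

open Classical in
theorem IsPolyTime.ite_leaf {c f g : Data → Data} (hc : IsPolyTime c) (hf : IsPolyTime f)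
    (hg : IsPolyTime g) : IsPolyTime fun x => if c x = .leaf then g x else f x := by
  obtain ⟨p₀, T₀, hT₀, h₀⟩ := hc
  obtain ⟨p, T, hT, h⟩ := hf
  obtain ⟨p', T', hT', h'⟩ := hg
  refine ⟨.ite p₀ p p', fun x => 1 + T₀ x + (T x + T' x), ((PolyBounded.const 1).add hT₀).add
    (hT.add hT'), fun x => ⟨?_, fun S => ?_⟩⟩
  · have h1 := (h x).1
    have h2 := (h' x).1
    dsimp only
    split <;> omega
  · obtain ⟨t₀, ht₀, e₀⟩ := (h₀ x).2 S
    obtain ⟨t, ht, e⟩ := (h x).2 S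
    obtain ⟨t', ht', e'⟩ := (h' x).2 S
    dsimp only
    cases hx : c x with
    | leaf =>
      rw [hx] at e₀
      rw [if_pos rfl]
      exact ⟨1 + t₀ + t', by omega, .ite_false e₀ e'⟩
    | node b b' =>
      rw [hx] at e₀
      rw [if_neg (by simp)]
      exact ⟨1 + t₀ + t, by omega, .ite_true e₀ e⟩

theorem IsPolyTime.congr {f g : Data → Data} (hf : IsPolyTime f) (h : ∀ x, f x = g x) :
    IsPolyTime g := (funext h : f = g) ▸ hf

/-- `P` is decided by a program without calls in polynomial time. -/
def IsPolyDec (P : Data → Prop) : Prop := IsPolyTime fun x => encProp (P x)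

theorem encProp_true : encProp True = .node .leaf .leaf := if_pos trivial

theorem encProp_false : encProp False = .leaf := if_neg not_false

theorem encProp_eq_leaf {P : Prop} : encProp P = .leaf ↔ ¬ P := by
  by_cases h : P <;> simp [h, encProp_true, encProp_false]

open Classical in
theorem IsPolyTime.ite {P : Data → Prop} {f g : Data → Data} (hP : IsPolyDec P)
    (hf : IsPolyTime f) (hg : IsPolyTime g) : IsPolyTime fun x => if P x then f x else g x := by
  refine (IsPolyTime.ite_leaf hP hf hg).congr fun x => ?_
  by_cases h : P x <;> simp [h, encProp_true, encProp_false]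

theorem IsPolyTime.true : IsPolyTime fun _ => .node .leaf .leaf := .node .leaf .leaf

theorem IsPolyDec.eq_leaf {f : Data → Data} (hf : IsPolyTime f) :
    IsPolyDec fun x => f x = .leaf := by
  classical
  refine (hf.ite_leaf .leaf .true).congr fun x => ?_
  by_cases h : f x = .leaf <;> simp [h, encProp_true, encProp_false]

theorem IsPolyDec.not {P : Data → Prop} (hP : IsPolyDec P) : IsPolyDec fun x => ¬ P x := by
  classical
  refine (IsPolyTime.ite hP .leaf .true).congr fun x => ?_
  by_cases h : P x <;> simp [h, encProp_true, encProp_false]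

theorem IsPolyDec.and {P Q : Data → Prop} (hP : IsPolyDec P) (hQ : IsPolyDec Q) :
    IsPolyDec fun x => P x ∧ Q x := by
  classical
  refine (IsPolyTime.ite hP hQ .leaf).congr fun x => ?_
  by_cases h : P x <;> simp [h, encProp_false]

theorem IsPolyDec.or {P Q : Data → Prop} (hP : IsPolyDec P) (hQ : IsPolyDec Q) :
    IsPolyDec fun x => P x ∨ Q x := by
  classical
  refine (IsPolyTime.ite hP .true hQ).congr fun x => ?_
  by_cases h : P x <;> simp [h, encProp_true]

theorem IsPolyDec.imp {P Q : Data → Prop} (hP : IsPolyDec P) (hQ : IsPolyDec Q) :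
    IsPolyDec fun x => P x → Q x := by
  classical
  refine (IsPolyTime.ite hP hQ .true).congr fun x => ?_
  by_cases h : P x <;> simp [h, encProp_true]

theorem IsPolyDec.comp {P : Data → Prop} {g : Data → Data} (hP : IsPolyDec P)
    (hg : IsPolyTime g) : IsPolyDec fun x => P (g x) := IsPolyTime.comp hP hg

end PolyTime

/-! ## Loops and folds -/

section Fold

/-- The states are prescribed as a sequence `s`. A pass costs at most `1 + 2 * B` for test and body;
the summand `1` in `N + 1` pays for the final failing test, and only the body may call the
subroutine. -/
theorem Eval.loop_iterate {S : Data → Data → ℕ → Prop} {c p : Prog} {B K : ℕ} (N : ℕ)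
    (s : ℕ → Data)
    (hc : ∀ i < N, ∃ b b' : Data, ∃ t ≤ B, Eval S c (s i) (.node b b') t 0)
    (hp : ∀ i < N, ∃ t ≤ B, ∃ k ≤ K, Eval S p (s i) (s (i + 1)) t k)
    (hend : ∃ t ≤ B, Eval S c (s N) .leaf t 0) :
    ∃ t ≤ (N + 1) * (1 + 2 * B), ∃ k ≤ N * K, Eval S (.loop c p) (s 0) (s N) t k := by
  induction N generalizing s with
  | zero =>
    obtain ⟨t, ht, e⟩ := hend
    exact ⟨1 + t, by omega, 0, by omega, .loop_done e⟩
  | succ N ih =>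
    obtain ⟨b, b', t, ht, e⟩ := hc 0 (by omega)
    obtain ⟨t', ht', k', hk', e'⟩ := hp 0 (by omega)
    obtain ⟨t'', ht'', k'', hk'', e''⟩ := ih (fun i => s (i + 1))
      (fun i hi => hc (i + 1) (by omega)) (fun i hi => hp (i + 1) (by omega)) hend
    refine ⟨1 + t + t' + t'', ?_, 0 + k' + k'', ?_, .loop_step e e' e''⟩
    · rw [Nat.succ_mul]
      omega
    · rw [Nat.succ_mul]
      omega

/-- The list that is encoded by a tree. -/
def Data.toList : Data → List Data
  | .leaf => []
  | .node a l => a :: l.toList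

@[simp] theorem toList_encList (l : List Data) : (encList l).toList = l := by
  induction l with
  | nil => rfl
  | cons a l ih => rw [encList, Data.toList, ih]

@[simp] theorem encList_toList (x : Data) : encList x.toList = x := by
  induction x with
  | leaf => rfl
  | node a l _ ih => rw [Data.toList, encList, ih]

theorem size_encList_drop_le (l : List Data) (i : ℕ) :
    (encList (l.drop i)).size ≤ (encList l).size := by
  induction l generalizing i with
  | nil => simp
  | cons a l ih =>
    cases i with
    | zero => simp
    | succ i =>
      rw [List.drop_succ_cons, encList, Data.size]
      exact (ih i).trans (by omega)

theorem length_lt_size_encList (l : List Data) : l.length < (encList l).size := by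
  induction l with
  | nil => simp [encList, Data.size]
  | cons a l ih =>
    rw [encList, Data.size, List.length_cons]
    have := a.one_le_size
    omega

theorem size_lt_of_mem {a : Data} {l : List Data} (h : a ∈ l) : a.size < (encList l).size := by
  induction l with
  | nil => simp at h
  | cons b l ih =>
    rw [encList, Data.size]
    rcases List.mem_cons.1 h with rfl | h
    · omega
    · have := ih h
      omega

theorem length_toList_lt (x : Data) : x.toList.length < x.size := by
  simpa using length_lt_size_encList x.toList

theorem size_lt_of_mem_toList {a x : Data} (h : a ∈ x.toList) : a.size < x.size := by
  simpa using size_lt_of_mem h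

/-- Folds over lists are computable in polynomial time if the intermediate results have polynomial
size. -/
theorem IsPolyTime.foldl {f : Data → Data → Data → Data} {l init : Data → Data} {b : Data → ℕ}
    (hf : IsPolyTime fun y => f y.fst y.snd.fst y.snd.snd) (hl : IsPolyTime l)
    (hinit : IsPolyTime init) (hb : PolyBounded b)
    (hfb : ∀ x i, (((l x).toList.take i).foldl (fun acc a => f x a acc) (init x)).size ≤ b x) :
    IsPolyTime fun x => (l x).toList.foldl (fun acc a => f x a acc) (init x) := by
  have hcond : IsPolyTime fun s => s.snd.fst := .fst (.snd .id)
  have hbody : IsPolyTime fun s =>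
      .node s.fst (.node s.snd.fst.snd (f s.fst s.snd.fst.fst s.snd.snd)) :=
    .node (.fst .id) (.node (.snd hcond) (.comp hf
      (.node (.fst .id) (.node (.fst hcond) (.snd (.snd .id))))))
  have hstart : IsPolyTime fun x => .node x (.node (l x) (init x)) := .node .id (.node hl hinit)
  have hfin : IsPolyTime fun s => s.snd.snd := .snd (.snd .id)
  have hlb := hl.polyBounded
  obtain ⟨pc, Tc, ⟨Qc, hQc⟩, hc⟩ := hcond
  obtain ⟨pb, Tb, ⟨Qb, hQb⟩, hb'⟩ := hbody
  obtain ⟨ps, Ts, hTs, hs⟩ := hstart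
  obtain ⟨pe, Te, ⟨Qe, hQe⟩, he⟩ := hfin
  let acc : Data → ℕ → Data := fun x i =>
    ((l x).toList.take i).foldl (fun acc a => f x a acc) (init x)
  -- The state holds the input, the unread rest of the list and the accumulator. The rest serves
  -- directly as the loop condition, as the empty list is `leaf`.
  let st : Data → ℕ → Data := fun x i =>
    .node x (.node (encList ((l x).toList.drop i)) (acc x i))
  let m : Data → ℕ := fun x => 2 + x.size + (l x).size + b x
  have hm : PolyBounded m := (((PolyBounded.const 2).add .size).add hlb).add hb
  have hst : ∀ x i, (st x i).size ≤ m x := by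
    intro x i
    have h1 := hfb x i
    have h2 := size_encList_drop_le (l x).toList i
    rw [encList_toList] at h2
    simp only [st, acc, m, Data.size]
    omega
  let B : Data → ℕ := fun x => Qc.eval (m x) + Qb.eval (m x)
  have hB : PolyBounded B := (hm.eval Qc).add (hm.eval Qb)
  refine ⟨.comp ps (.comp (.loop pc pb) pe), fun x =>
    1 + Ts x + (1 + ((l x).size + 1) * (1 + 2 * B x) + Qe.eval (m x)) + b x,
    ((((PolyBounded.const 1).add hTs).add (((PolyBounded.const 1).add ((hlb.add (.const 1)).mul
      ((PolyBounded.const 1).add ((PolyBounded.const 2).mul hB)))).add (hm.eval Qe))).add hb),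
    fun x => ⟨?_, fun S => ?_⟩⟩
  · have := hfb x (l x).toList.length
    rw [List.take_length] at this
    dsimp only
    omega
  · have hcx : ∀ i, ∃ t ≤ B x, Eval S pc (st x i) (encList ((l x).toList.drop i)) t 0 := by
      intro i
      obtain ⟨t, ht, e⟩ := (hc (st x i)).2 S
      exact ⟨t, (ht.trans ((hQc _).trans (polynomial_eval_mono Qc (hst x i)))).trans
        (Nat.le_add_right _ _), e⟩
    obtain ⟨t, ht, k, hk, e⟩ := Eval.loop_iterate (S := S) (c := pc) (p := pb) (B := B x) (K := 0)
      (l x).toList.length (st x) (by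
        intro i hi
        obtain ⟨t, ht, e⟩ := hcx i
        rw [List.drop_eq_getElem_cons hi] at e
        exact ⟨_, _, t, ht, e⟩) (by
        intro i hi
        obtain ⟨t, ht, e⟩ := (hb' (st x i)).2 S
        refine ⟨t, (ht.trans ((hQb _).trans (polynomial_eval_mono Qb (hst x i)))).trans
          (Nat.le_add_left _ _), 0, le_rfl, ?_⟩
        convert e using 1
        simp only [st, acc, Data.fst, Data.snd]
        rw [List.drop_eq_getElem_cons hi, List.take_add_one, List.getElem?_eq_getElem hi,
          Option.toList_some, List.foldl_append]
        rfl) (by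
        obtain ⟨t, ht, e⟩ := hcx (l x).toList.length
        rw [List.drop_length] at e
        exact ⟨t, ht, e⟩)
    obtain rfl : k = 0 := by omega
    obtain ⟨t', ht', e'⟩ := (hs x).2 S
    obtain ⟨t'', ht'', e''⟩ := (he (st x (l x).toList.length)).2 S
    have h0 : st x 0 = .node x (.node (l x) (init x)) := by simp [st, acc]
    have hN : (st x (l x).toList.length).snd.snd =
        (l x).toList.foldl (fun acc a => f x a acc) (init x) := by
      simp [st, acc, Data.snd]
    dsimp only at e''
    rw [h0] at e
    rw [hN] at e''
    refine ⟨1 + t' + (1 + t + t''), ?_, .comp e' (.comp e e'')⟩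
    have h1 := ht''.trans ((hQe _).trans (polynomial_eval_mono Qe (hst x _)))
    have h2 : ((l x).toList.length + 1) * (1 + 2 * B x) ≤ ((l x).size + 1) * (1 + 2 * B x) :=
      Nat.mul_le_mul_right _ (Nat.succ_le_succ (length_toList_lt _).le)
    dsimp only
    omega

end Fold

/-! ## Operations on lists, unary numbers and bounded quantifiers -/

section Lists

theorem size_encList_le {l : List Data} {B : ℕ} (h : ∀ a ∈ l, a.size ≤ B) :
    (encList l).size ≤ 1 + l.length * (1 + B) := by
  induction l with
  | nil => simp [encList, Data.size]
  | cons a l ih =>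
    have h1 := ih fun b hb => h b (List.mem_cons_of_mem a hb)
    have h2 := h a List.mem_cons_self
    rw [encList, Data.size, List.length_cons, Nat.succ_mul]
    omega

theorem foldl_node (g : Data → Data) (l : List Data) (acc : Data) :
    l.foldl (fun acc a => .node (g a) acc) acc = encList ((l.map g).reverse ++ acc.toList) := by
  induction l generalizing acc with
  | nil => simp
  | cons a l ih => simp [ih, Data.toList]

/-- A left fold that prepends its results reverses the list. The order is not restored, since only a
consistent order of rows and columns matters later. -/
theorem IsPolyTime.map_reverse {f : Data → Data → Data} {l : Data → Data}
    (hf : IsPolyTime fun y => f y.fst y.snd) (hl : IsPolyTime l) :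
    IsPolyTime fun x => encList ((l x).toList.map (f x)).reverse := by
  have hlb := hl.polyBounded
  obtain ⟨Q, hQ⟩ := hf.polyBounded
  refine (IsPolyTime.foldl (f := fun x a acc => .node (f x a) acc) (l := l)
    (init := fun _ => .leaf)
    (b := fun x => 1 + (l x).size * (1 + Q.eval (1 + x.size + (l x).size)))
    (.node (.comp hf (.node (.fst .id) (.fst (.snd .id)))) (.snd (.snd .id))) hl .leaf
    ((PolyBounded.const 1).add (hlb.mul ((PolyBounded.const 1).add
      ((PolyBounded.one_add_size.add hlb).eval Q)))) fun x i => ?_).congr fun x => ?_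
  · rw [foldl_node]
    refine (size_encList_le (B := Q.eval (1 + x.size + (l x).size)) fun a ha => ?_).trans ?_
    · simp only [Data.toList, List.append_nil, List.mem_reverse, List.mem_map] at ha
      obtain ⟨a, ha, rfl⟩ := ha
      have ha' := size_lt_of_mem_toList (List.mem_of_mem_take ha)
      refine (hQ (.node x a)).trans (polynomial_eval_mono Q ?_)
      simp only [Data.size]
      omega
    · have h1 := length_toList_lt (l x)
      simp only [Data.toList, List.append_nil, List.length_reverse, List.length_map,
        List.length_take]
      gcongr
      omega
  · rw [foldl_node]
    simp [Data.toList]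

open Classical in
theorem foldl_ite_node (P : Data → Prop) (l : List Data) (acc : Data) :
    l.foldl (fun acc a => if P a then .node a acc else acc) acc =
      encList ((l.filter (fun a => decide (P a))).reverse ++ acc.toList) := by
  induction l generalizing acc with
  | nil => simp
  | cons a l ih =>
    rw [List.foldl_cons, ih]
    by_cases h : P a <;> simp [h, Data.toList]

theorem size_encList_append (l l' : List Data) :
    (encList (l ++ l')).size + 1 = (encList l).size + (encList l').size := by
  induction l with
  | nil => simp [encList, Data.size, add_comm]
  | cons a l ih =>
    simp only [List.cons_append, encList, Data.size]
    omega

theorem size_encList_reverse (l : List Data) : (encList l.reverse).size = (encList l).size := by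
  induction l with
  | nil => rfl
  | cons a l ih =>
    have := size_encList_append l.reverse [a]
    simp only [List.reverse_cons, encList, Data.size] at this ⊢
    omega

theorem size_encList_sublist {l l' : List Data} (h : l.Sublist l') :
    (encList l).size ≤ (encList l').size := by
  induction h with
  | slnil => exact le_rfl
  | cons a _ ih => simp only [encList, Data.size]; omega
  | cons_cons a _ ih => simp only [encList, Data.size]; omega

open Classical in
theorem IsPolyTime.filter_reverse {P : Data → Data → Prop} {l : Data → Data}
    (hP : IsPolyDec fun y => P y.fst y.snd) (hl : IsPolyTime l) :
    IsPolyTime fun x => encList ((l x).toList.filter (fun a => decide (P x a))).reverse := by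
  refine (IsPolyTime.foldl (f := fun x a acc => if P x a then .node a acc else acc) (l := l)
    (init := fun _ => .leaf) (b := fun x => (l x).size)
    (.ite (hP.comp (.node (.fst .id) (.fst (.snd .id))))
      (.node (.fst (.snd .id)) (.snd (.snd .id))) (.snd (.snd .id))) hl .leaf
    hl.polyBounded fun x i => ?_).congr fun x => ?_
  · rw [foldl_ite_node]
    simp only [Data.toList, List.append_nil]
    rw [size_encList_reverse]
    refine (size_encList_sublist (List.filter_sublist.trans (List.take_sublist _ _))).trans ?_
    rw [encList_toList]
  · rw [foldl_ite_node]
    simp [Data.toList]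

open Classical in
theorem foldl_ite_leaf (P : Data → Prop) (l : List Data) (acc : Data) :
    l.foldl (fun acc a => if P a then acc else .leaf) acc =
      if ∀ a ∈ l, P a then acc else .leaf := by
  induction l generalizing acc with
  | nil => simp
  | cons a l ih =>
    rw [List.foldl_cons, ih]
    by_cases h : P a <;> simp [h]

theorem IsPolyDec.ball {P : Data → Data → Prop} {l : Data → Data}
    (hP : IsPolyDec fun y => P y.fst y.snd) (hl : IsPolyTime l) :
    IsPolyDec fun x => ∀ a ∈ (l x).toList, P x a := by
  classical
  refine (IsPolyTime.foldl (f := fun x a acc => if P x a then acc else .leaf) (l := l)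
    (init := fun _ => .node .leaf .leaf) (b := fun _ => 3)
    (.ite (hP.comp (.node (.fst .id) (.fst (.snd .id)))) (.snd (.snd .id)) .leaf) hl .true
    (.const 3) fun x i => ?_).congr fun x => ?_
  · rw [foldl_ite_leaf]
    split <;> simp [Data.size]
  · rw [foldl_ite_leaf]
    unfold encProp
    congr

theorem IsPolyDec.congr {P Q : Data → Prop} (hP : IsPolyDec P) (h : ∀ x, P x ↔ Q x) :
    IsPolyDec Q := (funext fun x => propext (h x) : P = Q) ▸ hP

theorem IsPolyDec.bex {P : Data → Data → Prop} {l : Data → Data}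
    (hP : IsPolyDec fun y => P y.fst y.snd) (hl : IsPolyTime l) :
    IsPolyDec fun x => ∃ a ∈ (l x).toList, P x a :=
  (IsPolyDec.ball (P := fun x a => ¬ P x a) hP.not hl).not.congr fun x => by simp

/-- The list without as many of its first elements as `b` has elements. -/
def dropLength (a b : Data) : Data := b.toList.foldl (fun acc _ => acc.snd) a

theorem toList_foldl_snd (l : List Data) (a : Data) :
    (l.foldl (fun acc _ => acc.snd) a).toList = a.toList.drop l.length := by
  induction l generalizing a with
  | nil => simp
  | cons b l ih =>
    rw [List.foldl_cons, ih]
    cases a <;> simp [Data.snd, Data.toList]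

theorem toList_dropLength (a b : Data) :
    (dropLength a b).toList = a.toList.drop b.toList.length := toList_foldl_snd _ _

theorem IsPolyTime.dropLength {f g : Data → Data} (hf : IsPolyTime f) (hg : IsPolyTime g) :
    IsPolyTime fun x => dropLength (f x) (g x) := by
  refine IsPolyTime.foldl (f := fun _ _ acc => acc.snd) (.snd (.snd (.snd .id))) hg hf
    hf.polyBounded fun x i => ?_
  have h := toList_foldl_snd ((g x).toList.take i) (f x)
  rw [← encList_toList (List.foldl _ _ _), h]
  refine (size_encList_drop_le _ _).trans ?_
  rw [encList_toList]

theorem toList_eq_nil {a : Data} : a.toList = [] ↔ a = .leaf := by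
  cases a <;> simp [Data.toList]

/-- Lists of the same length, that is, equal numbers. -/
def SameLength (a b : Data) : Prop := a.toList.length = b.toList.length

/-- The lengths agree when both truncated differences are empty. -/
theorem IsPolyDec.sameLength {f g : Data → Data} (hf : IsPolyTime f) (hg : IsPolyTime g) :
    IsPolyDec fun x => SameLength (f x) (g x) := by
  refine ((IsPolyDec.eq_leaf (hf.dropLength hg)).and (.eq_leaf (hg.dropLength hf))).congr
    fun x => ?_
  rw [← toList_eq_nil, ← toList_eq_nil, toList_dropLength, toList_dropLength, List.drop_eq_nil_iff,
    List.drop_eq_nil_iff, SameLength]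
  omega

/-- The product of two numbers. -/
def mulLength (a b : Data) : Data :=
  a.toList.foldl (fun acc _ => b.toList.foldl (fun acc _ => .node .leaf acc) acc) .leaf

theorem foldl_node_leaf (l : List Data) (acc : Data) :
    l.foldl (fun acc _ => .node .leaf acc) acc =
      encList (List.replicate l.length .leaf ++ acc.toList) := by
  rw [foldl_node]
  simp

theorem foldl_foldl_node_leaf (l l' : List Data) (acc : Data) :
    l.foldl (fun acc _ => l'.foldl (fun acc _ => .node .leaf acc) acc) acc =
      encList (List.replicate (l.length * l'.length) .leaf ++ acc.toList) := by
  induction l generalizing acc with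
  | nil => simp
  | cons a l ih =>
    rw [List.foldl_cons, ih, foldl_node_leaf, toList_encList, ← List.append_assoc,
      List.replicate_append_replicate, List.length_cons, Nat.succ_mul]

theorem length_toList_mulLength (a b : Data) :
    (mulLength a b).toList.length = a.toList.length * b.toList.length := by
  rw [mulLength, foldl_foldl_node_leaf]
  simp [Data.toList]

theorem size_encList_replicate_append (n : ℕ) (l : List Data) :
    (encList (List.replicate n .leaf ++ l)).size = 2 * n + (encList l).size := by
  induction n with
  | zero => simp
  | succ n ih =>
    simp only [List.replicate_succ, List.cons_append, encList, Data.size]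
    omega

/-- With unary numbers a doubly nested fold suffices, and its accumulator never exceeds the size of
the product. -/
theorem IsPolyTime.mulLength {f g : Data → Data} (hf : IsPolyTime f) (hg : IsPolyTime g) :
    IsPolyTime fun x => mulLength (f x) (g x) := by
  have hinner : IsPolyTime fun y : Data =>
      (g y.fst).toList.foldl (fun acc _ => .node .leaf acc) y.snd.snd := by
    have hg' : IsPolyTime fun y : Data => g y.fst := hg.comp (.fst .id)
    have hacc : IsPolyTime fun y : Data => y.snd.snd := .snd (.snd .id)
    refine IsPolyTime.foldl (f := fun _ _ acc => .node .leaf acc) (l := fun y => g y.fst)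
      (b := fun y => 2 * (g y.fst).size + y.snd.snd.size) (.node .leaf (.snd (.snd .id))) hg' hacc
      (((PolyBounded.const 2).mul hg'.polyBounded).add hacc.polyBounded) fun x i => ?_
    rw [foldl_node_leaf, size_encList_replicate_append, encList_toList, List.length_take]
    have := length_toList_lt (g x.fst)
    omega
  refine IsPolyTime.foldl (f := fun x _ acc =>
    (g x).toList.foldl (fun acc _ => .node .leaf acc) acc) (init := fun _ => .leaf)
    (b := fun x => 2 * ((f x).size * (g x).size) + 1)
    hinner hf .leaf (((PolyBounded.const 2).mul (hf.polyBounded.mul hg.polyBounded)).add (.const 1))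
    fun x i => ?_
  rw [foldl_foldl_node_leaf, size_encList_replicate_append, encList_toList, List.length_take]
  have h1 := length_toList_lt (f x)
  have h2 := length_toList_lt (g x)
  have : min i (f x).toList.length * (g x).toList.length ≤ (f x).size * (g x).size := by
    gcongr
    omega
  simp only [Data.size]
  omega

@[simp] theorem toList_encNat (n : ℕ) : (encNat n).toList = List.replicate n .leaf := by
  induction n with
  | zero => rfl
  | succ n ih => rw [encNat, Data.toList, ih, List.replicate_succ]

theorem encNat_eq_encList (n : ℕ) : encNat n = encList (List.replicate n .leaf) := by
  rw [← toList_encNat, encList_toList]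

@[simp] theorem sameLength_encNat (m n : ℕ) : SameLength (encNat m) (encNat n) ↔ m = n := by
  simp [SameLength]

@[simp] theorem sameLength_encNat_mulLength (m n k : ℕ) :
    SameLength (encNat k) (mulLength (encNat m) (encNat n)) ↔ k = m * n := by
  rw [SameLength, length_toList_mulLength]
  simp

end Lists

/-! ## Numbered vertex lists -/

section Vertices

/-- The list of the vertices of an encoded graph, each with its number, in reverse order. -/
def vertexList (x : Data) : Data :=
  x.toList.foldl (fun acc a =>
    Data.node (.node (encList (acc.toList.map fun _ => .leaf).reverse) a) acc) .leaf

/-- The number of a vertex is the length of the accumulator at the time the vertex is read. -/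
theorem toList_foldl_vertices (l : List Data) :
    (l.foldl (fun acc a =>
      Data.node (.node (encList (acc.toList.map fun _ => .leaf).reverse) a) acc) .leaf).toList =
      (l.mapIdx fun i a => Data.node (encNat i) a).reverse := by
  induction l using List.reverseRecOn with
  | nil => rfl
  | append_singleton l a ih =>
    rw [List.foldl_append, List.mapIdx_append, List.reverse_append, ← ih]
    simp only [List.foldl_cons, List.foldl_nil, Data.toList]
    rw [ih]
    simp [encNat_eq_encList, List.map_const']

theorem toList_vertexList (x : Data) :
    (vertexList x).toList = (x.toList.mapIdx fun i a => .node (encNat i) a).reverse :=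
  toList_foldl_vertices _

theorem size_encNat (n : ℕ) : (encNat n).size = 2 * n + 1 := by
  induction n with
  | zero => rfl
  | succ n ih =>
    simp only [encNat, Data.size]
    omega

theorem IsPolyTime.vertexList : IsPolyTime vertexList := by
  refine IsPolyTime.foldl (f := fun _ a acc =>
    .node (.node (encList (acc.toList.map fun _ => .leaf).reverse) a) acc) (l := fun x => x)
    (init := fun _ => .leaf) (b := fun x => 1 + x.size * (3 + 3 * x.size))
    (.node (.node (.map_reverse (f := fun _ _ => .leaf) .leaf (.snd (.snd .id))) (.fst (.snd .id)))
      (.snd (.snd .id))) .id .leaf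
    ((PolyBounded.const 1).add (PolyBounded.size.mul ((PolyBounded.const 3).add
      ((PolyBounded.const 3).mul .size)))) fun x i => ?_
  rw [← encList_toList (List.foldl _ _ _), toList_foldl_vertices, size_encList_reverse]
  have h1 := length_toList_lt x
  -- An entry with number `j` has size `1 + (2 * j + 1)` plus that of the row, and both `j` and the
  -- row are smaller than `x.size`.
  refine (size_encList_le (B := 2 + 3 * x.size) fun a ha => ?_).trans ?_
  · obtain ⟨j, hj, rfl⟩ := List.mem_mapIdx.1 ha
    rw [List.length_take] at hj
    have h2 := size_lt_of_mem_toList (List.mem_of_mem_take (List.getElem_mem (l := x.toList.take i)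
      (by rwa [List.length_take] : j < (x.toList.take i).length)))
    simp only [Data.size, size_encNat]
    omega
  · rw [List.length_mapIdx, List.length_take]
    have : min i x.toList.length * (1 + (2 + 3 * x.size)) ≤ x.size * (3 + 3 * x.size) :=
      Nat.mul_le_mul (by omega) (by omega)
    omega

/-- The number of a vertex. -/
abbrev vIdx (v : Data) : Data := v.fst

/-- The colour of a vertex. -/
abbrev vCol (v : Data) : Data := v.snd.fst

/-- There is an edge from `u` to `v`. -/
def VAdj (u v : Data) : Prop := (dropLength u.snd.snd (vIdx v)).fst ≠ .leaf

/-- `u` equals `v` or `v` has an edge to `u`. -/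
def VBelow (u v : Data) : Prop := SameLength (vIdx u) (vIdx v) ∨ VAdj v u

/-- The condition `ColDigraph.Atom` for a vertex of the vertex list `g`. -/
def VAtom (g a : Data) : Prop :=
  ¬ SameLength (vCol a) (encNat 1) ∧
    ∀ u ∈ g.toList, VBelow u a → SameLength (vIdx u) (vIdx a) ∨ SameLength (vCol u) (encNat 1)

/-- The condition `ColDigraph.Primary` for a vertex of the vertex list `g`. -/
def VPrimary (g p v : Data) : Prop :=
  ∀ u ∈ g.toList, VBelow u v → SameLength (vCol u) (encNat 1) ∨
    ∃ w ∈ g.toList, VBelow w u ∧ SameLength (vCol w) p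

/-- The condition `ColDigraph.IsProductLike` for the graph with the vertex list `g`. -/
def VIsProductLike (g : Data) : Prop :=
  (∀ u ∈ g.toList, ∀ v ∈ g.toList, ∀ w ∈ g.toList, VBelow u v → VBelow v w → VBelow u w) ∧
  (∀ u ∈ g.toList, ∀ v ∈ g.toList, VBelow u v → VBelow v u → SameLength (vIdx u) (vIdx v)) ∧
  (∃ e ∈ g.toList, SameLength (vCol e) (encNat 1) ∧
    ∀ z ∈ g.toList, VBelow z e → SameLength (vCol z) (encNat 1)) ∧
  (∀ u ∈ g.toList, ∀ v ∈ g.toList, (∀ a ∈ g.toList, VAtom g a → ∀ z ∈ g.toList, VBelow z u →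
    VPrimary g (vCol a) z → VBelow z v) → VBelow u v) ∧
  (∀ a ∈ g.toList, VAtom g a → ∀ v ∈ g.toList, ∃ m ∈ g.toList, VBelow m v ∧
    VPrimary g (vCol a) m ∧ ∀ z ∈ g.toList, VBelow z v → VPrimary g (vCol a) z → VBelow z m) ∧
  ∀ v ∈ g.toList, ∀ w ∈ g.toList, (∀ a ∈ g.toList, ∀ b ∈ g.toList, VAtom g a → VAtom g b →
    VBelow a v → VBelow b w → ¬ SameLength (vCol a) (vCol b)) →
    ∃ u ∈ g.toList, VBelow v u ∧ VBelow w u ∧ SameLength (vCol u) (mulLength (vCol v) (vCol w)) ∧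
      ∀ a ∈ g.toList, VAtom g a → ∀ z ∈ g.toList, VPrimary g (vCol a) z → VBelow z u →
        VBelow z v ∨ VBelow z w

open Classical in
/-- The vertices in the list `g` that are primary for the colour `p`. -/
noncomputable def primaryVertices (g p : Data) : Data :=
  encList (g.toList.filter fun v => decide (VPrimary g p v)).reverse

/-- The encoding of the graph induced on the list `l` of vertices. -/
noncomputable def encInduced (l : Data) : Data :=
  encList (l.toList.map fun u =>
    .node (vCol u) (encList (l.toList.map fun v => encProp (VAdj u v)).reverse)).reverse

/-! ### Polynomial-time decidability of the graph conditions -/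

section PolyTime

variable {f g h : Data → Data}

theorem IsPolyTime.vIdx (hf : IsPolyTime f) : IsPolyTime fun x => vIdx (f x) := .fst hf

theorem IsPolyTime.vCol (hf : IsPolyTime f) : IsPolyTime fun x => vCol (f x) := .fst (.snd hf)

theorem IsPolyDec.vAdj (hf : IsPolyTime f) (hg : IsPolyTime g) :
    IsPolyDec fun x => VAdj (f x) (g x) :=
  .not (.eq_leaf (.fst (.dropLength (.snd (.snd hf)) (.fst hg))))

theorem IsPolyDec.vBelow (hf : IsPolyTime f) (hg : IsPolyTime g) :
    IsPolyDec fun x => VBelow (f x) (g x) :=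
  .or (.sameLength (.fst hf) (.fst hg)) (.vAdj hg hf)

theorem IsPolyTime.encNat_one : IsPolyTime fun _ => encNat 1 := .true

theorem IsPolyDec.vAtom (hg : IsPolyTime g) (hf : IsPolyTime f) :
    IsPolyDec fun x => VAtom (g x) (f x) := by
  have hf' : IsPolyTime fun y : Data => f y.fst := hf.comp (.fst .id)
  refine .and (.not (.sameLength (.vCol hf) .encNat_one)) (.ball (P := fun x u => VBelow u (f x) →
    SameLength (PowRec.vIdx u) (PowRec.vIdx (f x)) ∨ SameLength (PowRec.vCol u) (encNat 1)) ?_ hg)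
  exact .imp (.vBelow (.snd .id) hf') (.or (.sameLength (.vIdx (.snd .id)) (.vIdx hf'))
    (.sameLength (.vCol (.snd .id)) .encNat_one))

theorem IsPolyDec.vPrimary (hg : IsPolyTime g) (hh : IsPolyTime h) (hf : IsPolyTime f) :
    IsPolyDec fun x => VPrimary (g x) (h x) (f x) := by
  refine .ball (P := fun x u => VBelow u (f x) → SameLength (PowRec.vCol u) (encNat 1) ∨
    ∃ w ∈ (g x).toList, VBelow w u ∧ SameLength (PowRec.vCol w) (h x)) ?_ hg
  refine .imp (.vBelow (.snd .id) (hf.comp (.fst .id))) (.or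
    (.sameLength (.vCol (.snd .id)) .encNat_one) (.bex (P := fun y w => VBelow w y.snd ∧
      SameLength (PowRec.vCol w) (h y.fst)) ?_ (hg.comp (.fst .id))))
  exact .and (.vBelow (.snd .id) (.snd (.fst .id)))
    (.sameLength (.vCol (.snd .id)) (hh.comp (.fst (.fst .id))))

/-- All quantifiers range over the vertex list, so the proof follows the syntax of the formula.
Reducible transparency keeps `VBelow`, `VAtom` and `VPrimary` folded, so that their own lemmas
apply. -/
theorem IsPolyDec.vIsProductLike : IsPolyDec VIsProductLike := by
  unfold VIsProductLike
  repeat' with_reducible first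
    | exact IsPolyTime.id
    | exact IsPolyTime.encNat_one
    | apply IsPolyDec.and
    | apply IsPolyDec.ball
    | apply IsPolyDec.bex
    | apply IsPolyDec.not
    | apply IsPolyDec.or
    | apply IsPolyDec.imp
    | apply IsPolyDec.vBelow
    | apply IsPolyDec.vAtom
    | apply IsPolyDec.vPrimary
    | apply IsPolyDec.sameLength
    | apply IsPolyTime.mulLength
    | apply IsPolyTime.vIdx
    | apply IsPolyTime.vCol
    | apply IsPolyTime.fst
    | apply IsPolyTime.snd

open Classical in
theorem IsPolyTime.primaryVertices (hg : IsPolyTime g) (hh : IsPolyTime h) :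
    IsPolyTime fun x => primaryVertices (g x) (h x) :=
  .filter_reverse (P := fun x v => VPrimary (g x) (h x) v)
    (.vPrimary (hg.comp (.fst .id)) (hh.comp (.fst .id)) (.snd .id)) hg

theorem IsPolyTime.encInduced (hf : IsPolyTime f) : IsPolyTime fun x => encInduced (f x) := by
  refine .map_reverse (f := fun x u => .node (PowRec.vCol u)
    (encList ((f x).toList.map fun v => encProp (VAdj u v)).reverse))
    (.node (.vCol (.snd .id)) ?_) hf
  exact .map_reverse (f := fun y v => encProp (VAdj y.snd v))
    (IsPolyDec.vAdj (.snd (.fst .id)) (.snd .id)) (hf.comp (.fst .id))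

end PolyTime

end Vertices

/-! ## The vertex list of an encoded graph -/

section Semantics

variable {n : ℕ} (C : ColDigraph (Fin n))

/-- The entry of the vertex `i` in the vertex list. -/
noncomputable def vertexData (i : Fin n) : Data :=
  .node (encNat i) (.node (encNat (C.col i)) (encList (List.ofFn fun j => encProp (C.Adj i j))))

theorem toList_vertexList_encGraph :
    (vertexList (encGraph C)).toList = (List.finRange n).reverse.map (vertexData C) := by
  rw [toList_vertexList, encGraph, toList_encList, List.map_reverse]
  congr 1
  apply List.ext_getElem
  · simp
  · intro i h1 h2
    simp [vertexData]

theorem forall_mem_vertexList {P : Data → Prop} :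
    (∀ a ∈ (vertexList (encGraph C)).toList, P a) ↔ ∀ i, P (vertexData C i) := by
  rw [toList_vertexList_encGraph]
  simp

theorem exists_mem_vertexList {P : Data → Prop} :
    (∃ a ∈ (vertexList (encGraph C)).toList, P a) ↔ ∃ i, P (vertexData C i) := by
  rw [toList_vertexList_encGraph]
  simp

theorem sameLength_vIdx (i j : Fin n) :
    SameLength (vIdx (vertexData C i)) (vIdx (vertexData C j)) ↔ i = j :=
  (sameLength_encNat _ _).trans Fin.ext_iff.symm

theorem vCol_vertexData (i : Fin n) : vCol (vertexData C i) = encNat (C.col i) := rfl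

theorem fst_eq_headD (x : Data) : x.fst = x.toList.headD .leaf := by
  cases x <;> rfl

theorem vAdj_vertexData (i j : Fin n) :
    VAdj (vertexData C i) (vertexData C j) ↔ C.Adj i j := by
  -- Removing `j` entries from the row of `i` leaves the entry for `j` at the head.
  have h : (dropLength (encList (List.ofFn fun j => encProp (C.Adj i j))) (encNat j)).fst =
      encProp (C.Adj i j) := by
    rw [fst_eq_headD, toList_dropLength, toList_encList, toList_encNat, List.length_replicate,
      List.drop_eq_getElem_cons (by simp)]
    simp
  show (dropLength (encList (List.ofFn fun j => encProp (C.Adj i j))) (encNat j)).fst ≠ .leaf ↔ _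
  rw [h, Ne, encProp_eq_leaf, not_not]

theorem vBelow_vertexData (i j : Fin n) :
    VBelow (vertexData C i) (vertexData C j) ↔ C.Below i j :=
  or_congr (sameLength_vIdx C i j) (vAdj_vertexData C j i)

theorem vAtom_vertexData (i : Fin n) :
    VAtom (vertexList (encGraph C)) (vertexData C i) ↔ C.Atom i := by
  simp only [VAtom, forall_mem_vertexList, vBelow_vertexData, sameLength_vIdx, vCol_vertexData,
    sameLength_encNat, ColDigraph.Atom, ne_eq]

theorem vPrimary_vertexData (p : ℕ) (i : Fin n) :
    VPrimary (vertexList (encGraph C)) (encNat p) (vertexData C i) ↔ C.Primary p i := by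
  simp only [VPrimary, forall_mem_vertexList, exists_mem_vertexList, vBelow_vertexData,
    vCol_vertexData, sameLength_encNat, ColDigraph.Primary]

theorem vIsProductLike_vertexList :
    VIsProductLike (vertexList (encGraph C)) ↔ C.IsProductLike := by
  simp only [VIsProductLike, forall_mem_vertexList, exists_mem_vertexList, vBelow_vertexData,
    vCol_vertexData, sameLength_encNat, sameLength_vIdx, vAtom_vertexData, vPrimary_vertexData,
    sameLength_encNat_mulLength]
  exact ⟨fun ⟨h1, h2, h3, h4, h5, h6⟩ => ⟨h1, h2, h3, h4, h5, h6⟩,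
    fun ⟨h1, h2, h3, h4, h5, h6⟩ => ⟨h1, h2, h3, h4, h5, h6⟩⟩

theorem encInduced_map_vertexData (l : List (Fin n)) :
    encInduced (encList (l.map (vertexData C))) =
      encGraph (C.comap fun k : Fin l.reverse.length => l.reverse.get k) := by
  have key : ∀ {α : Type} (F : Fin n → α),
      List.ofFn (fun k : Fin l.reverse.length => F (l.reverse.get k)) = (l.map F).reverse := by
    intro α F
    rw [← List.map_reverse]
    conv_rhs => rw [← List.ofFn_get l.reverse, List.map_ofFn]
    rfl
  have h := key fun i => Data.node (encNat (C.col i))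
    (encList (List.ofFn fun k : Fin l.reverse.length => encProp (C.Adj i (l.reverse.get k))))
  rw [encInduced, toList_encList, encGraph]
  refine congrArg encList (Eq.trans ?_ h.symm)
  rw [List.map_map]
  congr 1
  refine List.map_congr_left fun i _ => ?_
  refine Eq.trans ?_ (congrArg (fun l => Data.node (encNat (C.col i)) (encList l))
    (key fun j => encProp (C.Adj i j)).symm)
  simp only [Function.comp, vCol_vertexData, List.map_map]
  refine congrArg (fun l => Data.node _ (encList (List.reverse l))) ?_
  refine List.map_congr_left fun j _ => ?_
  exact congrArg encProp (propext (vAdj_vertexData C i j))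

/-- This certifies that the tree handed to the subroutine is the encoding of an induced graph;
injectivity holds because the vertex list has no repetitions. -/
theorem exists_encInduced_eq (p : ℕ) :
    ∃ (m : ℕ) (e : Fin m → Fin n), Function.Injective e ∧
      (∀ v, v ∈ Set.range e ↔ C.Primary p v) ∧
      encInduced (primaryVertices (vertexList (encGraph C)) (encNat p)) =
        encGraph (C.comap e) := by
  classical
  let l : List (Fin n) := ((List.finRange n).reverse.filter fun v => decide (C.Primary p v)).reverse
  have hl : primaryVertices (vertexList (encGraph C)) (encNat p) =
      encList (l.map (vertexData C)) := by
    rw [primaryVertices, toList_vertexList_encGraph, List.filter_map, ← List.map_reverse]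
    refine congrArg (fun l => encList (List.map (vertexData C) (List.reverse l))) ?_
    refine List.filter_congr fun i _ => ?_
    simp only [Function.comp, vPrimary_vertexData]
  refine ⟨_, _, ?_, fun v => ?_, hl ▸ encInduced_map_vertexData C l⟩
  · refine List.nodup_iff_injective_get.1 ?_
    simp only [l, List.reverse_reverse]
    exact (List.nodup_reverse.2 (List.nodup_finRange n)).filter _
  · rw [Set.mem_range, ← List.mem_iff_get]
    simp [l]

end Semantics

/-! ## The reduction program -/

section Program

/-- Allowing any `m` above the input size lets all parts of the main loop be bounded at one common
argument. -/
theorem IsPolyTime.exists_polynomial {f : Data → Data} (hf : IsPolyTime f) :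
    ∃ (p : Prog) (Q : Polynomial ℕ), ∀ x m, x.size ≤ m → (f x).size ≤ Q.eval m ∧
      ∀ S, ∃ t ≤ Q.eval m, Eval S p x (f x) t 0 := by
  obtain ⟨p, T, ⟨Q, hQ⟩, h⟩ := hf
  refine ⟨p, Q, fun x m hm => ?_⟩
  have hT := (hQ x).trans (polynomial_eval_mono Q hm)
  refine ⟨(h x).1.trans hT, fun S => ?_⟩
  obtain ⟨t, ht, e⟩ := (h x).2 S
  exact ⟨t, ht.trans hT, e⟩

open Classical in
/-- One step of the main loop: if `patom` answers "yes", then the subroutine is called on the value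
of `psub`, and the truth value computed so far is replaced by "no" if the subroutine says "no". -/
theorem Eval.call_step {S : Data → Data → ℕ → Prop} {pg pl pacc patom psub : Prog}
    {s g l acc sub : Data} {P R : Prop} {B B' : ℕ}
    (hg : ∃ t ≤ B, Eval S pg s g t 0) (hl : ∃ t ≤ B, Eval S pl s l t 0)
    (hacc : ∃ t ≤ B, Eval S pacc s acc t 0) (hatom : ∃ t ≤ B, Eval S patom s (encProp P) t 0)
    (hsub : ∃ t ≤ B, Eval S psub s sub t 0) (hs : 1 < s.size) (hsB : s.size ≤ B)
    (hsubB : sub.size ≤ B)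
    (hcall : P → ∃ y, ∃ t ≤ B', S sub y t ∧ (y = .leaf ↔ ¬ R)) :
    ∃ t ≤ 10 + 7 * B + B', ∃ k ≤ 1, Eval S
      (.pair pg (.pair pl (.ite (.ite patom (.comp psub .call) .id) pacc .leaf))) s
      (.node g (.node l (if P → R then acc else .leaf))) t k := by
  obtain ⟨t1, h1, e1⟩ := hg
  obtain ⟨t2, h2, e2⟩ := hl
  obtain ⟨t3, h3, e3⟩ := hacc
  obtain ⟨t4, h4, e4⟩ := hatom
  obtain ⟨t5, h5, e5⟩ := hsub
  suffices h : ∃ t ≤ 7 + 5 * B + B', ∃ k ≤ 1, Eval S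
      (.ite (.ite patom (.comp psub .call) .id) pacc .leaf) s
      (if P → R then acc else .leaf) t k by
    obtain ⟨t, ht, k, hk, e⟩ := h
    exact ⟨1 + t1 + (1 + t2 + t), by omega, 0 + (0 + k), by omega, .pair e1 (.pair e2 e)⟩
  by_cases hP : P
  · obtain ⟨y, t6, h6, hy, hyR⟩ := hcall hP
    have e4' : Eval S patom s (.node .leaf .leaf) t4 0 := by
      rwa [encProp, if_pos hP] at e4
    have e6 := Eval.ite_true (q := .id) e4' (Eval.comp e5 (.call hy))
    by_cases hR : R
    · rw [if_pos fun _ => hR]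
      cases y with
      | leaf => exact absurd hR (hyR.1 rfl)
      | node b b' => exact ⟨_, by omega, _, by omega, .ite_true e6 e3⟩
    · rw [if_neg fun h => hR (h hP)]
      obtain rfl := hyR.2 hR
      exact ⟨_, by omega, _, by omega, .ite_false e6 (.leaf s)⟩
  · rw [if_pos fun h => absurd h hP]
    have e4' : Eval S patom s .leaf t4 0 := by
      rwa [encProp, if_neg hP] at e4
    have e6 := Eval.ite_false (p := .comp psub .call) e4' (Eval.id s)
    -- Without a call the inner test returns the whole state, which counts as "yes" because `hs`
    -- excludes `leaf`; the accumulator is then kept.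
    cases s with
    | leaf => simp [Data.size] at hs
    | node b b' => exact ⟨_, by omega, _, by omega, .ite_true e6 e3⟩

/-- The program is assembled before `X` and `A` are introduced; only the polynomial bound depends on
`A`. Each of the `n` passes makes at most one call, whence the constant `1`. -/
theorem exists_reduction_program :
    ∃ M : Prog, ∀ (X : (G : Type) → [Group G] → Prop),
      (∀ (G : Type) [Group G], X G → ∃ p k : ℕ, p.Prime ∧ Nat.card G = p ^ k) →
      (∀ (G H : Type) [Group G] [Group H], Nonempty (G ≃* H) → X G → X H) →
      ∀ A : Prog, IsPolyRecognizer X A → IsPolyDeciderWithCalls (Nil X) A M 1 := by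
  classical
  have fsts : IsPolyTime fun s => s.fst := .fst .id
  have hd : IsPolyTime fun s => s.snd.fst.fst := .fst (.fst (.snd .id))
  obtain ⟨pv, Qv, hv⟩ := IsPolyTime.vertexList.exists_polynomial
  obtain ⟨pc, Qc, hc⟩ := IsPolyTime.exists_polynomial IsPolyDec.vIsProductLike
  obtain ⟨ps, Qs, hs⟩ := (IsPolyTime.node .id (.node .id .true)).exists_polynomial
  obtain ⟨pr, Qr, hr⟩ := (IsPolyTime.fst (.snd .id)).exists_polynomial
  obtain ⟨pg, Qg, hg⟩ := fsts.exists_polynomial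
  obtain ⟨pl, Ql, hl⟩ := (IsPolyTime.snd (.fst (.snd .id))).exists_polynomial
  obtain ⟨pacc, Qacc, hacc⟩ := (IsPolyTime.snd (.snd .id)).exists_polynomial
  obtain ⟨patom, Qatom, hatom⟩ := IsPolyTime.exists_polynomial (IsPolyDec.vAtom fsts hd)
  obtain ⟨psub, Qsub, hsub⟩ :=
    (IsPolyTime.encInduced (.primaryVertices fsts (.vCol hd))).exists_polynomial
  refine ⟨.comp pv (.ite pc (.comp ps (.comp (.loop pr (.pair pg (.pair pl
    (.ite (.ite patom (.comp psub .call) .id) pacc .leaf)))) pacc)) .leaf), ?_⟩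
  rintro X hpp hiso A ⟨P, hA⟩
  -- A bound for the loop state: two nodes, the vertex list, a tail of it, and a truth value of size
  -- at most `3`.
  let m : Polynomial ℕ := 5 + 2 * Qv
  -- The summand `X` covers the size of the state, and `Qsub` covers both the time to build the
  -- query and its size.
  let B : Polynomial ℕ := (Polynomial.X + Qr + Qg + Ql + Qacc + Qatom + Qsub).comp m
  let B' : Polynomial ℕ := 10 + 7 * B + P.comp B
  refine ⟨10 + 2 * Qv + Qc.comp Qv + Qs.comp Qv + (Qv + 1) * (1 + 2 * B') + B, fun n C hC => ?_⟩
  have hm : ∀ N, m.eval N = 5 + 2 * Qv.eval N := fun N => by simp [m]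
  have hB : ∀ N, B.eval N = m.eval N + Qr.eval (m.eval N) + Qg.eval (m.eval N) +
      Ql.eval (m.eval N) + Qacc.eval (m.eval N) + Qatom.eval (m.eval N) +
      Qsub.eval (m.eval N) := fun N => by simp [B]
  have hB' : ∀ N, B'.eval N = 10 + 7 * B.eval N + P.eval (B.eval N) := fun N => by simp [B']
  set N := (encGraph C).size with hN
  set g := vertexList (encGraph C) with hgdef
  have hgsize : g.size ≤ Qv.eval N := (hv _ _ le_rfl).1
  obtain ⟨tv, htv, ev⟩ := (hv (encGraph C) N le_rfl).2 (Run A)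
  obtain ⟨tc, htc, ec⟩ := (hc g _ hgsize).2 (Run A)
  have hcorrect : IsRDPowOf (Nil X) C ↔
      C.IsProductLike ∧ ∀ a, C.Atom a → IsRDPowOf X (C.primaryPart (C.col a)) :=
    ⟨isProductLike_of_isRDPowOf_nil hpp, fun h => h.1.isRDPowOf_nil hC.irrefl hpp hiso h.2⟩
  have heval : (10 + 2 * Qv + Qc.comp Qv + Qs.comp Qv + (Qv + 1) * (1 + 2 * B') + B).eval N =
      10 + 2 * Qv.eval N + Qc.eval (Qv.eval N) + Qs.eval (Qv.eval N) +
        (Qv.eval N + 1) * (1 + 2 * B'.eval N) + B.eval N := by simp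
  rw [heval]
  by_cases hprod : C.IsProductLike
  swap
  · rw [(vIsProductLike_vertexList C).not.2 hprod |> eq_false, encProp_false] at ec
    have : ¬ IsRDPowOf (Nil X) C := fun h => hprod (hcorrect.1 h).1
    rw [eq_false this, encProp_false]
    refine ⟨_, _, .comp ev (.ite_false ec (.leaf g)), ?_, by omega⟩
    omega
  rw [eq_true ((vIsProductLike_vertexList C).2 hprod), encProp_true] at ec
  obtain ⟨ts, hts, es⟩ := (hs g _ hgsize).2 (Run A)
  let R : Fin n → Prop := fun i => IsRDPowOf X (C.primaryPart (C.col i))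
  let L : List (Fin n) := (List.finRange n).reverse
  have hL : g.toList = L.map (vertexData C) := toList_vertexList_encGraph C
  have hLn : L.length = n := by simp [L]
  let acc : ℕ → Data := fun i => encProp (∀ v ∈ L.take i, C.Atom v → R v)
  let st : ℕ → Data := fun i => .node g (.node (encList (g.toList.drop i)) (acc i))
  have hst : ∀ i, (st i).size ≤ m.eval N := by
    intro i
    have h1 := size_encList_drop_le g.toList i
    rw [encList_toList] at h1
    have h2 : (acc i).size ≤ 3 := by
      simp only [acc, encProp]
      split <;> simp [Data.size]
    simp only [st, Data.size]
    rw [hm]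
    omega
  have hcond : ∀ i, ∃ t ≤ B'.eval N, Eval (Run A) pr (st i) (encList (g.toList.drop i)) t 0 := by
    intro i
    obtain ⟨t, ht, e⟩ := (hr _ _ (hst i)).2 (Run A)
    refine ⟨t, ?_, e⟩
    rw [hB', hB]
    omega
  obtain ⟨t, ht, k, hk, e⟩ := Eval.loop_iterate (S := Run A) (c := pr)
    (p := .pair pg (.pair pl (.ite (.ite patom (.comp psub .call) .id) pacc .leaf)))
    (B := B'.eval N) (K := 1) n st
    (by
      intro i hi
      obtain ⟨t, ht, e⟩ := hcond i
      rw [List.drop_eq_getElem_cons (by rwa [hL, List.length_map, hLn])] at e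
      exact ⟨_, _, t, ht, e⟩)
    (by
      intro i hi
      have hiL : i < L.length := hLn.symm ▸ hi
      have hdrop : g.toList.drop i = vertexData C L[i] :: g.toList.drop (i + 1) := by
        rw [List.drop_eq_getElem_cons (by rwa [hL, List.length_map, hLn])]
        simp [hL]
      have hhead : (st i).snd.fst.fst = vertexData C L[i] := by
        simp only [st, hdrop, encList, Data.snd, Data.fst]
      have htail : (st i).snd.fst.snd = encList (g.toList.drop (i + 1)) := by
        simp only [st, hdrop, encList, Data.snd, Data.fst]
      have hacc' : acc (i + 1) = if C.Atom L[i] → R L[i] then acc i else .leaf := by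
        simp only [acc, List.take_add_one, List.getElem?_eq_getElem hiL, Option.toList_some]
        by_cases h : C.Atom L[i] → R L[i]
        · rw [if_pos h]
          refine congrArg encProp (propext ⟨fun h' v hv => h' v (List.mem_append_left _ hv),
            fun h' v hv => ?_⟩)
          rcases List.mem_append.1 hv with hv | hv
          · exact h' v hv
          · rw [List.mem_singleton.1 hv]
            exact h
        · rw [if_neg h]
          exact encProp_eq_leaf.2 fun h' => h (h' _ (List.mem_append_right _ (by simp)))
      have hwiden : ∀ {p : Prog} {y : Data} {b : ℕ}, b ≤ B.eval N →
          (∃ t ≤ b, Eval (Run A) p (st i) y t 0) → ∃ t ≤ B.eval N, Eval (Run A) p (st i) y t 0 :=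
        fun hb ⟨t, ht, e⟩ => ⟨t, ht.trans hb, e⟩
      have hsubst := hsub _ _ (hst i)
      have hatomst := (hatom _ _ (hst i)).2 (Run A)
      dsimp only at hatomst
      rw [hhead] at hsubst hatomst
      have hatomeq : VAtom (st i).fst (vertexData C L[i]) = C.Atom L[i] :=
        propext (vAtom_vertexData C L[i])
      rw [hatomeq] at hatomst
      have key := Eval.call_step (R := R L[i]) (B' := P.eval (B.eval N))
        (hwiden (by rw [hB]; omega) ((hg _ _ (hst i)).2 (Run A)))
        (hwiden (by rw [hB]; omega) ((hl _ _ (hst i)).2 (Run A)))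
        (hwiden (by rw [hB]; omega) ((hacc _ _ (hst i)).2 (Run A)))
        (hwiden (by rw [hB]; omega) hatomst)
        (hwiden (by rw [hB]; omega) (hsubst.2 (Run A)))
        (by
          simp only [st, Data.size]
          have := g.one_le_size
          omega)
        ((hst i).trans (by rw [hB]; omega)) (hsubst.1.trans (by rw [hB]; omega))
        (by
          intro hat
          obtain ⟨d, f, hf, hrange, henc⟩ := exists_encInduced_eq C (C.col L[i])
          have hsubeq : encInduced (primaryVertices (st i).fst (vCol (vertexData C L[i]))) =
              encGraph (C.comap f) := henc
          -- Primary vertices are closed under out-neighbours once `Below` is transitive; this is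
          -- why the axioms are tested before any call is made.
          have hred : IsReducedDigraph (C.comap f) := hC.comap hf fun w v hwv => by
            rw [hrange]
            have hw := (hrange (f w)).1 ⟨w, rfl⟩
            exact fun u hu => hw u (hprod.trans _ _ _ hu (Or.inr hwv))
          obtain ⟨y, t, hy, ht, hans⟩ := hA d (C.comap f) hred
          rw [hsubeq] at hsubst ⊢
          refine ⟨y, t, ht.trans (polynomial_eval_mono P (hsubst.1.trans (by rw [hB]; omega))),
            hy, ?_⟩
          show _ ↔ ¬ IsRDPowOf X (C.primaryPart (C.col L[i]))
          rw [← isRDPowOf_comap_iff hf hrange]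
          -- Only the shape of the answer is used: a group with an isomorphism is a node and so
          -- differs from "no".
          refine ⟨fun h h' => ?_, hans.2⟩
          obtain ⟨G, _, _, e, f, -, hyn⟩ := hans.1 h'
          rw [h] at hyn
          exact Data.noConfusion hyn)
      obtain ⟨t, ht, k, hk, e⟩ := key
      refine ⟨t, by rw [hB']; exact ht, k, hk, ?_⟩
      rw [htail, ← show acc (i + 1) = if C.Atom L[i] → R L[i] then (st i).snd.snd else .leaf
        from hacc'] at e
      exact e)
    (by
      obtain ⟨t, ht, e⟩ := hcond n
      rw [List.drop_eq_nil_of_le (by rw [hL, List.length_map, hLn])] at e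
      exact ⟨t, ht, e⟩)
  have h0 : st 0 = .node g (.node g (.node .leaf .leaf)) := by
    simp [st, acc, encProp]
  obtain ⟨te, hte, ee⟩ := (hacc _ _ (hst n)).2 (Run A)
  have hres : (st n).snd.snd = encProp (IsRDPowOf (Nil X) C) := by
    refine congrArg encProp (propext ?_)
    rw [hcorrect, List.take_of_length_le hLn.le]
    exact ⟨fun h => ⟨hprod, fun a ha => h a (by simp [L]) ha⟩, fun h v _ => h.2 v⟩
  rw [hres] at ee
  rw [h0] at e
  refine ⟨_, _, .comp ev (.ite_true ec (.comp es (.comp e ee))), ?_, by omega⟩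
  have hn : n ≤ Qv.eval N := by
    have := length_toList_lt g
    rw [hL, List.length_map, hLn] at this
    omega
  have h1 : (n + 1) * (1 + 2 * B'.eval N) ≤ (Qv.eval N + 1) * (1 + 2 * B'.eval N) :=
    Nat.mul_le_mul_right _ (by omega)
  have h2 : Qacc.eval (m.eval N) ≤ B.eval N := by rw [hB]; omega
  omega

end Program

end PowRec

theorem lemma6 :
    -- the reduction: one program, which uses the given algorithm only as a subroutine
    (∃ (M : PowRec.Prog) (c : ℕ), ∀ (X : (G : Type) → [Group G] → Prop),
      -- `X` is a class of finite groups of prime power order, closed under isomorphism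
      (∀ (G : Type) [Group G], X G → ∃ p k : ℕ, p.Prime ∧ Nat.card G = p ^ k) →
      (∀ (G H : Type) [Group G] [Group H], Nonempty (G ≃* H) → X G → X H) →
      ∀ A : PowRec.Prog, PowRec.IsPolyRecognizer X A →
        PowRec.IsPolyDeciderWithCalls (PowRec.Nil X) A M c) ∧
    -- the colour-isomorphisms of the Sylow parts glue, via least common parents
    (∀ (ι : Type) [Fintype ι] (p : ι → ℕ) (hp : ∀ i, (p i).Prime), Function.Injective p →
      ∀ (G H : ι → Type) [∀ i, Group (G i)] [∀ i, Group (H i)] [∀ i, Finite (G i)]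
        [∀ i, Finite (H i)] (_ : ∀ i, ∃ k : ℕ, Nat.card (G i) = p i ^ k)
        (hH : ∀ i, ∃ k : ℕ, Nat.card (H i) = p i ^ k)
        (f : ∀ i, PowRec.ColIso ((PowRec.rdpow (∀ j, H j)).part (p i))
          ((PowRec.rdpow (∀ j, G j)).part (p i))),
      ∃ F : PowRec.ColIso (PowRec.rdpow (∀ j, H j)) (PowRec.rdpow (∀ j, G j)),
        (∀ i v, F v.1 = (f i v).1) ∧
        ∀ (x : ∀ j, H j) (w : PowRec.TwinClass (PowRec.dpow (∀ j, G j))),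
          PowRec.IsLeastCommonParent (PowRec.rdpow (∀ j, G j))
            (fun i => (f i (PowRec.singleVertex (hp i) H i (hH i) (x i))).1) w ↔
          w = F (PowRec.pcls x)) := by
  refine ⟨?_, ?_⟩
  · obtain ⟨M, hM⟩ := PowRec.exists_reduction_program
    exact ⟨M, 1, hM⟩
  · intro ι _ p hp hinj G H _ _ _ _ hG hH f
    exact PowRec.IsPrimePowerFamily.glue ⟨hp, hinj, hG⟩ ⟨hp, hinj, hH⟩ f
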